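/- Let $p>q\ge 2$ be integers, let $c\in\mathbb C$, and consider the correspondence $z\mapsto w$ given by $(w-c)^q=z^p$; then $w$ is called an image of $z$. For a finite orbit $(z_0,\dots,z_n)$ (each $z_{i+1}$ an image of $z_i$) avoiding $0$, let $g_{z_0\cdots z_n}=g_{z_{n-1},z_n}\circ\cdots\circ g_{z_0,z_1}$, where $g_{z_i,z_{i+1}}$ is the unique holomorphic germ $g$ at $z_i$ with $(g(z)-c)^q=z^p$ and $g(z_i)=z_{i+1}$. The finite orbit is a repelling cycle of period $n\ge 1$ if $z_n=z_0$, $z_i\ne z_0$ for $0<i<n$, no $z_i$ is $0$, and $|g_{z_0\cdots z_n}'(z_0)|>1$. The Julia set $J\subset\mathbb C$ is the closure of the union of all repelling cycles. Assume that $J$ (nonempty) is a hyperbolic repeller: $J$ is compact, $0\notin J$, the set of points having at least one image in $J$ equals $J$, and there are $C>0$, $\lambda>1$ with $|g_{z_0\cdots z_n}'(z_0)|\ge C\lambda^n$ for all finite orbits $(z_0,\dots,z_n)$ in $J$. Assume also that the correspondence is locally eventually onto on $J$: for every nonempty relatively open $U\subset J$ there is $n>0$ such that the $n$-th iterated image of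 $U$ contains $J$. A $\mathbb C^2$-extension is a holomorphic map $f:V\to\mathbb C^2$ on an open set $V\subset\mathbb C^2$ such that the closure $J(f)$ of the set of its periodic points is a compact subset of $V$, is completely invariant ($f(J(f))=J(f)=f^{-1}(J(f))$), and such that, with $\pi(z,w)=z$, the map $x\mapsto(\pi f^n(x))_{n\ge 0}$ is a bijection (hence a homeomorphism conjugating $f$ to the shift) from $J(f)$ onto the space of forward orbits of the correspondence contained in $J$. Its geometric potential is $\varphi(x)=-\log|g_{z_0,z_1}'(z_0)|$ with $z_0=\pi(x)$, $z_1=\pi f(x)$, $x\in J(f)$. Let $P(\cdot)$ denote the topological pressure of $f:J(f)\to J(f)$. Then $\mathbb C^2$-extensions exist, and there is a real number $t_c>0$ such that, for every $\mathbb C^2$-extension, $t_c$ is the unique zero of $t\mapsto P(t\varphi)$ on $[0,\infty)$. Moreover, the $t_c$-dimensional Hausdorff measure $\mathcal H^{t_c}(J)$ is finite, and $\dim_H J\le t_c$. -/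

import Mathlib

open Filter Topology MeasureTheory

noncomputable section

namespace Corr

/-! ### The correspondence `(w - c)^q = z^p` -/

/-- `w` is an image of `z` under the correspondence `(w - c)^q = z^p`. -/
def IsImage (p q : ℕ) (c z w : ℂ) : Prop := (w - c) ^ q = z ^ p

/-- The set of all images of points of `A`. -/
def imageSet (p q : ℕ) (c : ℂ) (A : Set ℂ) : Set ℂ := {w | ∃ z ∈ A, IsImage p q c z w}

/-- The set of all points with at least one image in `A`. -/
def preimageSet (p q : ℕ) (c : ℂ) (A : Set ℂ) : Set ℂ := {z | ∃ w ∈ A, IsImage p q c z w}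

/-- `(z 0, …, z n)` is a finite orbit (the values of `z` beyond `n` are irrelevant). -/
def IsFiniteOrbit (p q : ℕ) (c : ℂ) (n : ℕ) (z : ℕ → ℂ) : Prop :=
  ∀ i < n, IsImage p q c (z i) (z (i + 1))

/-- The holomorphic branch `g` of the correspondence near `z₀ ≠ 0` with `g z₀ = z₁`, where
`z₁` is an image of `z₀`. The power is the principal one, near `z / z₀ = 1`; see
`localBranch_self`, `eventually_isImage_localBranch` and `eventually_eq_localBranch`. -/
def localBranch (p q : ℕ) (c z₀ z₁ : ℂ) : ℂ → ℂ :=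
  fun z => c + (z₁ - c) * (z / z₀) ^ ((p : ℂ) / (q : ℂ))

/-- The composition `g_{z_{n-1}, z_n} ∘ ⋯ ∘ g_{z_0, z_1}` along a finite orbit. -/
def orbitBranch (p q : ℕ) (c : ℂ) (z : ℕ → ℂ) : ℕ → ℂ → ℂ
  | 0 => id
  | n + 1 => localBranch p q c (z n) (z (n + 1)) ∘ orbitBranch p q c z n

theorem localBranch_self (p q : ℕ) (c z₁ : ℂ) {z₀ : ℂ} (h₀ : z₀ ≠ 0) :
    localBranch p q c z₀ z₁ z₀ = z₁ := by
  simp [localBranch, h₀]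

theorem hasDerivAt_localBranch (p q : ℕ) (c z₁ : ℂ) {z₀ : ℂ} (h₀ : z₀ ≠ 0) :
    HasDerivAt (localBranch p q c z₀ z₁) (p * (z₁ - c) / (q * z₀)) z₀ := by
  have h1 : HasDerivAt (fun z : ℂ => z / z₀) (1 / z₀) z₀ := (hasDerivAt_id z₀).div_const z₀
  have h2 := (h1.cpow_const (c := (p : ℂ) / (q : ℂ)) (by simp [h₀])).const_mul (z₁ - c)
  have h3 := h2.const_add c
  refine HasDerivAt.congr_deriv h3 ?_
  rw [show (z₀ / z₀ : ℂ) = 1 from div_self h₀, Complex.one_cpow, mul_one]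
  field_simp

/-- `localBranch` solves the equation of the correspondence near `z₀`. -/
theorem eventually_isImage_localBranch (p q : ℕ) (c : ℂ) {z₀ z₁ : ℂ} (hq : q ≠ 0)
    (h₀ : z₀ ≠ 0) (h : IsImage p q c z₀ z₁) :
    ∀ᶠ z in 𝓝 z₀, IsImage p q c z (localBranch p q c z₀ z₁ z) := by
  refine Eventually.of_forall fun z => ?_
  have hq' : (q : ℂ) ≠ 0 := by exact_mod_cast hq
  unfold IsImage at *
  simp only [localBranch, add_sub_cancel_left, mul_pow, h]
  rw [← Complex.cpow_mul_nat, div_mul_cancel₀ _ hq', Complex.cpow_natCast, ← mul_pow,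
    mul_div_cancel₀ _ h₀]

/-- `localBranch` is the only continuous solution near `z₀` with value `z₁` at `z₀`. -/
theorem eventually_eq_localBranch (p q : ℕ) (c : ℂ) {z₀ z₁ : ℂ} (hq : q ≠ 0)
    (h₀ : z₀ ≠ 0) {g : ℂ → ℂ} (hg : ContinuousAt g z₀)
    (hg₀ : g z₀ = z₁) (hgi : ∀ᶠ z in 𝓝 z₀, IsImage p q c z (g z)) :
    g =ᶠ[𝓝 z₀] localBranch p q c z₀ z₁ := by
  have h : IsImage p q c z₀ z₁ := hg₀ ▸ hgi.self_of_nhds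
  have hne : z₁ - c ≠ 0 := by
    intro h0
    unfold IsImage at h
    rw [h0, zero_pow hq] at h
    exact pow_ne_zero p h₀ h.symm
  have hb := (hasDerivAt_localBranch p q c z₁ h₀).continuousAt
  have hb₀ := localBranch_self p q c z₁ h₀
  let r : ℂ → ℂ := fun z => (g z - c) / (localBranch p q c z₀ z₁ z - c)
  have hr : ContinuousAt r z₀ :=
    (hg.sub continuousAt_const).div (hb.sub continuousAt_const) (by rw [hb₀]; exact hne)
  have hr₀ : r z₀ = 1 := by simp only [r]; rw [hg₀, hb₀, div_self hne]
  have hfin : ({x : ℂ | x ^ q = 1} \ {1}).Finite := by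
    refine Set.Finite.subset (Polynomial.nthRootsFinset q (1 : ℂ)).finite_toSet ?_
    intro x hx
    simpa [Polynomial.mem_nthRootsFinset (Nat.pos_of_ne_zero hq)] using hx.1
  have hop : ({x : ℂ | x ^ q = 1} \ {1})ᶜ ∈ 𝓝 (r z₀) := by
    rw [hr₀]
    exact hfin.isClosed.isOpen_compl.mem_nhds (by simp)
  have hbne : ∀ᶠ z in 𝓝 z₀, localBranch p q c z₀ z₁ z - c ≠ 0 :=
    ContinuousAt.eventually_ne (g := fun z => localBranch p q c z₀ z₁ z - c)
      (hb.sub continuousAt_const) (by rw [hb₀]; exact hne)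
  filter_upwards [hr hop, hgi, eventually_isImage_localBranch p q c hq h₀ h, hbne]
    with z h1 h2 h3 h4
  have hrz : r z ^ q = 1 := by
    simp only [r, div_pow]
    unfold IsImage at h2 h3
    rw [h2, ← h3, div_self (pow_ne_zero _ h4)]
  have hr1 : r z = 1 := by
    by_contra hcon
    exact h1 ⟨hrz, hcon⟩
  have := (div_eq_one_iff_eq h4).1 hr1
  exact sub_left_injective this

/-! ### Julia set, hyperbolic repellers -/

/-- `(z 0, …, z n)` is a repelling cycle of period `n`; none of its points is zero. -/
def IsRepellingCycle (p q : ℕ) (c : ℂ) (n : ℕ) (z : ℕ → ℂ) : Prop :=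
  0 < n ∧ IsFiniteOrbit p q c n z ∧ z n = z 0 ∧ (∀ i, 0 < i → i < n → z i ≠ z 0) ∧
    (∀ i ≤ n, z i ≠ 0) ∧ 1 < ‖deriv (orbitBranch p q c z n) (z 0)‖

/-- The Julia set: the closure of the union of all repelling cycles. -/
def juliaSet (p q : ℕ) (c : ℂ) : Set ℂ :=
  closure {w | ∃ n z, IsRepellingCycle p q c n z ∧ ∃ i ≤ n, z i = w}

structure IsHyperbolicRepeller (p q : ℕ) (c : ℂ) (Λ : Set ℂ) : Prop where
  isCompact : IsCompact Λ
  zero_notMem : (0 : ℂ) ∉ Λ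
  preimage_eq : preimageSet p q c Λ = Λ
  expanding : ∃ C > (0 : ℝ), ∃ l > (1 : ℝ), ∀ (n : ℕ) (z : ℕ → ℂ), IsFiniteOrbit p q c n z →
    (∀ i ≤ n, z i ∈ Λ) → C * l ^ n ≤ ‖deriv (orbitBranch p q c z n) (z 0)‖

/-- Locally eventually onto: each nonempty relatively open subset `O ∩ Λ` of `Λ` is mapped over
`Λ` by some iterate of the correspondence. -/
def IsLEO (p q : ℕ) (c : ℂ) (Λ : Set ℂ) : Prop :=
  ∀ O : Set ℂ, IsOpen O → (O ∩ Λ).Nonempty → ∃ n > 0, Λ ⊆ (imageSet p q c)^[n] (O ∩ Λ)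

/-! ### Extensions to `ℂ²` -/

/-- The closure in `ℂ²` of the set of periodic points of the map `f : V → ℂ²`. The values of `f`
outside `V` play no role: the whole orbit has to lie in `V`. -/
def closurePeriodicPts (V : Set (ℂ × ℂ)) (f : ℂ × ℂ → ℂ × ℂ) : Set (ℂ × ℂ) :=
  closure {x | (∃ n > 0, f^[n] x = x) ∧ ∀ i, f^[i] x ∈ V}

/-- The projected orbit of `x`: the first coordinates of its iterates. -/
def projectedOrbit (f : ℂ × ℂ → ℂ × ℂ) (x : ℂ × ℂ) : ℕ → ℂ := fun n => (f^[n] x).1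

/-- The set of all forward orbits of the correspondence contained in `Λ`. -/
def orbitSpace (p q : ℕ) (c : ℂ) (Λ : Set ℂ) : Set (ℕ → ℂ) :=
  {z | ∀ i, z i ∈ Λ ∧ IsImage p q c (z i) (z (i + 1))}

/-- The holomorphic map `f : V → ℂ²` is a `ℂ²`-extension of the correspondence: the closure
`J(f)` of its periodic points is a compact subset of `V`, completely invariant, and taking
projected orbits is a bijection from `J(f)` onto the space of forward orbits in the Julia set.
(This bijection is continuous, hence a homeomorphism for the product topology, and it conjugates
`f` to the shift.) -/
structure IsC2Extension (p q : ℕ) (c : ℂ) (V : Set (ℂ × ℂ)) (f : ℂ × ℂ → ℂ × ℂ) : Prop where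
  isOpen : IsOpen V
  holomorphic : DifferentiableOn ℂ f V
  isCompact : IsCompact (closurePeriodicPts V f)
  subset : closurePeriodicPts V f ⊆ V
  image_eq : f '' closurePeriodicPts V f = closurePeriodicPts V f
  preimage_eq : V ∩ f ⁻¹' closurePeriodicPts V f = closurePeriodicPts V f
  bijOn : Set.BijOn (projectedOrbit f) (closurePeriodicPts V f)
    (orbitSpace p q c (juliaSet p q c))

/-- The geometric potential `x ↦ -log |g_{z₀, z₁}'(z₀)|`, where `z₀, z₁` are the first two points
of the projected orbit of `x`. -/
def geometricPotential (p q : ℕ) (c : ℂ) (f : ℂ × ℂ → ℂ × ℂ) (x : ℂ × ℂ) : ℝ :=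
  -Real.log ‖deriv (localBranch p q c (projectedOrbit f x 0) (projectedOrbit f x 1))
    (projectedOrbit f x 0)‖

/-! ### Topological pressure -/

/-- `E` is an `(n, ε)`-separated subset of `K`. -/
def IsSeparatedIn {X : Type*} [MetricSpace X] (f : X → X) (K : Set X) (n : ℕ) (ε : ℝ)
    (E : Finset X) : Prop :=
  (E : Set X) ⊆ K ∧ ∀ x ∈ E, ∀ y ∈ E, x ≠ y → ∃ j < n, ε < dist (f^[j] x) (f^[j] y)

/-- The supremum of `∑ x ∈ E, exp (S_n φ x)` over all `(n, ε)`-separated subsets `E` of `K`. -/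
def partitionSup {X : Type*} [MetricSpace X] (f : X → X) (K : Set X) (φ : X → ℝ) (n : ℕ)
    (ε : ℝ) : ENNReal :=
  ⨆ (E : Finset X) (_ : IsSeparatedIn f K n ε E),
    ∑ x ∈ E, ENNReal.ofReal (Real.exp (birkhoffSum f φ n x))

/-- The topological pressure of the potential `φ` for `f : K → K`, `K` compact:
`lim_{ε → 0} limsup_n (1/n) log sup_E ∑_{x ∈ E} exp (S_n φ x)`, `E` ranging over the
`(n, ε)`-separated sets; the limit as `ε → 0` is a supremum by monotonicity. -/
def pressure {X : Type*} [MetricSpace X] (f : X → X) (K : Set X) (φ : X → ℝ) : EReal :=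
  ⨆ (ε : ℝ) (_ : 0 < ε),
    limsup (fun n : ℕ => ENNReal.log (partitionSup f K φ n ε) / ((n : ℝ) : EReal)) atTop

end Corr

end

noncomputable section

namespace Corr

/-- The logarithm of the modulus of the derivative at `z` of every branch of the correspondence. -/
def logExpansion (p q : ℕ) (z : ℂ) : ℝ :=
  Real.log ((p : ℝ) / q) + ((p : ℝ) / q - 1) * Real.log ‖z‖

/-- The Birkhoff sum of `logExpansion` along the first `n` points of a sequence. -/
def logExpansionSum (p q : ℕ) (z : ℕ → ℂ) (n : ℕ) : ℝ :=
  ∑ i ∈ Finset.range n, logExpansion p q (z i)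

theorem IsImage.sub_ne_zero {p q : ℕ} {c z w : ℂ} (hq : q ≠ 0) (h : IsImage p q c z w)
    (hz : z ≠ 0) : w - c ≠ 0 := by
  intro h0
  unfold IsImage at h
  rw [h0, zero_pow hq] at h
  exact pow_ne_zero p hz h.symm

theorem IsImage.log_norm_sub {p q : ℕ} {c z w : ℂ} (hq : q ≠ 0) (h : IsImage p q c z w) :
    Real.log ‖w - c‖ = (p : ℝ) / q * Real.log ‖z‖ := by
  have h1 := congrArg (fun u : ℂ => Real.log ‖u‖) h
  simp only [norm_pow, Real.log_pow] at h1
  have hq' : (q : ℝ) ≠ 0 := by exact_mod_cast hq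
  field_simp
  linarith

theorem IsImage.norm_deriv {p q : ℕ} {c z w : ℂ} (hp : p ≠ 0) (hq : q ≠ 0)
    (h : IsImage p q c z w) (hz : z ≠ 0) :
    ‖(p * (w - c) / (q * z) : ℂ)‖ = Real.exp (logExpansion p q z) := by
  have hw : 0 < ‖w - c‖ := norm_pos_iff.2 (h.sub_ne_zero hq hz)
  have hz' : 0 < ‖z‖ := norm_pos_iff.2 hz
  have hq' : (0 : ℝ) < q := by positivity
  have hp' : (0 : ℝ) < p := by positivity
  rw [logExpansion, sub_mul, ← h.log_norm_sub hq, one_mul, ← Real.log_div hw.ne' hz'.ne',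
    ← Real.log_mul (by positivity) (by positivity), Real.exp_log (by positivity)]
  simp only [norm_div, norm_mul, Complex.norm_natCast]
  field_simp

theorem orbitBranch_self (p q : ℕ) (c : ℂ) (z : ℕ → ℂ) (n : ℕ) (hz : ∀ i < n, z i ≠ 0) :
    orbitBranch p q c z n (z 0) = z n := by
  induction n with
  | zero => rfl
  | succ n ih =>
    simp only [orbitBranch, Function.comp]
    rw [ih fun i hi => hz i (by omega), localBranch_self p q c _ (hz n (by omega))]

theorem exists_hasDerivAt_orbitBranch {p q : ℕ} {c : ℂ} (hp : p ≠ 0) (hq : q ≠ 0) {z : ℕ → ℂ}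
    {n : ℕ} (hz : ∀ i < n, z i ≠ 0) (h : IsFiniteOrbit p q c n z) :
    ∃ D : ℂ, HasDerivAt (orbitBranch p q c z n) D (z 0) ∧
      ‖D‖ = Real.exp (logExpansionSum p q z n) := by
  induction n with
  | zero => exact ⟨1, hasDerivAt_id _, by simp [logExpansionSum]⟩
  | succ n ih =>
    obtain ⟨D, hD, hn⟩ := ih (fun i hi => hz i (by omega)) fun i hi => h i (by omega)
    have h1 : HasDerivAt (localBranch p q c (z n) (z (n + 1)))
        (p * (z (n + 1) - c) / (q * z n)) (orbitBranch p q c z n (z 0)) := by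
      rw [orbitBranch_self p q c z n fun i hi => hz i (by omega)]
      exact hasDerivAt_localBranch p q c (z (n + 1)) (hz n (by omega))
    refine ⟨_, h1.comp (z 0) hD, ?_⟩
    rw [norm_mul, hn,
      (h n (by omega)).norm_deriv hp hq (hz n (by omega)), ← Real.exp_add, logExpansionSum,
      logExpansionSum, Finset.sum_range_succ, add_comm]

theorem norm_one_add_cpow_sub_one_le {α : ℝ} (h0 : 0 ≤ α) (h1 : α ≤ 1) {u : ℂ}
    (hu : ‖u‖ ≤ 1 / 2) : ‖(1 + u) ^ (α : ℂ) - 1‖ ≤ α * (1 + 2 * ‖u‖) * ‖u‖ := by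
  have hbound : ∀ x ∈ Metric.closedBall (0 : ℂ) ‖u‖,
      HasDerivWithinAt (fun x : ℂ => (1 + x) ^ (α : ℂ)) (α * (1 + x) ^ ((α : ℂ) - 1))
        (Metric.closedBall (0 : ℂ) ‖u‖) x := by
    intro x hx
    have hx' : ‖x‖ ≤ 1 / 2 := by
      have := mem_closedBall_zero_iff.1 hx
      linarith
    have hs : 1 + x ∈ Complex.slitPlane := by
      refine Complex.mem_slitPlane_of_norm_lt_one (by linarith)
    have := ((hasDerivAt_id x).const_add 1).cpow_const (c := (α : ℂ)) hs
    simpa using this.hasDerivWithinAt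
  have hle : ∀ x ∈ Metric.closedBall (0 : ℂ) ‖u‖,
      ‖(α * (1 + x) ^ ((α : ℂ) - 1) : ℂ)‖ ≤ α * (1 + 2 * ‖u‖) := by
    intro x hx
    have hx' : ‖x‖ ≤ ‖u‖ := mem_closedBall_zero_iff.1 hx
    have hlow : 1 - ‖u‖ ≤ ‖1 + x‖ := by
      have := norm_sub_norm_le (1 : ℂ) (-x)
      simp at this
      linarith
    have hpos : 0 < 1 - ‖u‖ := by linarith
    rw [norm_mul, Complex.norm_real, Real.norm_of_nonneg h0]
    refine mul_le_mul_of_nonneg_left ?_ h0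
    rw [show (α : ℂ) - 1 = ((α - 1 : ℝ) : ℂ) by push_cast; ring,
      Complex.norm_cpow_real]
    calc ‖1 + x‖ ^ (α - 1) ≤ (1 - ‖u‖) ^ (α - 1) :=
          Real.rpow_le_rpow_of_nonpos hpos hlow (by linarith)
      _ ≤ (1 - ‖u‖) ^ (-1 : ℝ) :=
          Real.rpow_le_rpow_of_exponent_ge hpos (by linarith [norm_nonneg u]) (by linarith)
      _ ≤ 1 + 2 * ‖u‖ := by
          rw [Real.rpow_neg_one, inv_le_iff_one_le_mul₀ hpos]
          nlinarith [norm_nonneg u]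
  have := (convex_closedBall (0 : ℂ) ‖u‖).norm_image_sub_le_of_norm_hasDerivWithin_le hbound hle
    (Metric.mem_closedBall_self (norm_nonneg u)) (by simp : u ∈ Metric.closedBall (0 : ℂ) ‖u‖)
  simpa using this

/-- An inverse branch of the correspondence is almost as contracting as its derivative. -/
theorem IsImage.exists_isImage_near {p q : ℕ} {c y₀ y₁ w : ℂ} (hq : q ≠ 0) (hpq : q ≤ p)
    (h : IsImage p q c y₀ y₁) (h₀ : y₀ ≠ 0) (hw : ‖w - y₁‖ ≤ ‖y₁ - c‖ / 2) :
    ∃ x, IsImage p q c x w ∧ ‖x - y₀‖ ≤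
      Real.exp (-logExpansion p q y₀) * (1 + 2 / ‖y₁ - c‖ * ‖w - y₁‖) * ‖w - y₁‖ := by
  have hp : p ≠ 0 := by omega
  have h₁ : y₁ - c ≠ 0 := h.sub_ne_zero hq h₀
  have h₁' : 0 < ‖y₁ - c‖ := norm_pos_iff.2 h₁
  have h₀' : 0 < ‖y₀‖ := norm_pos_iff.2 h₀
  have hq' : (0 : ℝ) < q := by positivity
  have hp' : (0 : ℝ) < p := by positivity
  have hpC : (p : ℂ) ≠ 0 := by exact_mod_cast hp
  set u : ℂ := (w - y₁) / (y₁ - c) with hu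
  have hun : ‖u‖ = ‖w - y₁‖ / ‖y₁ - c‖ := by rw [hu, norm_div]
  have hu2 : ‖u‖ ≤ 1 / 2 := by rw [hun, div_le_iff₀ h₁']; linarith
  have key := norm_one_add_cpow_sub_one_le (α := (q : ℝ) / p) (by positivity)
    ((div_le_one hp').2 (by exact_mod_cast hpq)) hu2
  refine ⟨y₀ * (1 + u) ^ (((q : ℝ) / p : ℝ) : ℂ), ?_, ?_⟩
  · unfold IsImage at *
    have : (((q : ℝ) / p : ℝ) : ℂ) * p = q := by
      push_cast; field_simp
    rw [mul_pow, ← h, ← Complex.cpow_mul_nat, this, Complex.cpow_natCast, ← mul_pow]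
    congr 1
    rw [hu]; field_simp; ring
  · rw [show y₀ * (1 + u) ^ (((q : ℝ) / p : ℝ) : ℂ) - y₀ =
      y₀ * ((1 + u) ^ (((q : ℝ) / p : ℝ) : ℂ) - 1) by ring, norm_mul]
    refine (mul_le_mul_of_nonneg_left key h₀'.le).trans (le_of_eq ?_)
    rw [Real.exp_neg, ← h.norm_deriv hp hq h₀, hun]
    simp only [norm_div, norm_mul, Complex.norm_natCast]
    field_simp

theorem exists_root_separation {k : ℕ} (hk : k ≠ 0) :
    ∃ κ > (0 : ℝ), ∀ u v : ℂ, u ^ k = v ^ k → ‖u - v‖ < κ * ‖v‖ → u = v := by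
  have hfin : ({x : ℂ | x ^ k = 1} \ {1}).Finite := by
    refine Set.Finite.subset (Polynomial.nthRootsFinset k (1 : ℂ)).finite_toSet ?_
    intro x hx
    simpa [Polynomial.mem_nthRootsFinset (Nat.pos_of_ne_zero hk)] using hx.1
  have hop : ({x : ℂ | x ^ k = 1} \ {1})ᶜ ∈ 𝓝 (1 : ℂ) :=
    hfin.isClosed.isOpen_compl.mem_nhds (by simp)
  obtain ⟨κ, hκ, hb⟩ := Metric.mem_nhds_iff.1 hop
  refine ⟨κ, hκ, fun u v huv hlt => ?_⟩
  have hv : 0 < ‖v‖ := by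
    by_contra hcon
    have : ‖v‖ = 0 := le_antisymm (not_lt.1 hcon) (norm_nonneg _)
    rw [this, mul_zero] at hlt
    exact absurd hlt (not_lt.2 (norm_nonneg _))
  have hv0 : v ≠ 0 := norm_pos_iff.1 hv
  have hmem : u / v ∈ Metric.ball (1 : ℂ) κ := by
    rw [mem_ball_iff_norm, div_sub_one hv0, norm_div, div_lt_iff₀ hv]
    exact hlt
  by_contra hne
  refine hb hmem ⟨?_, fun h1 => hne ((div_eq_one_iff_eq hv0).1 h1)⟩
  simp only [Set.mem_ofPred_eq, div_pow, huv]
  exact div_self (pow_ne_zero _ hv0)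

theorem IsFiniteOrbit.mono {p q : ℕ} {c : ℂ} {m n : ℕ} {z : ℕ → ℂ}
    (h : IsFiniteOrbit p q c n z) (hmn : m ≤ n) : IsFiniteOrbit p q c m z :=
  fun i hi => h i (by omega)

theorem IsFiniteOrbit.drop {p q : ℕ} {c : ℂ} {m n : ℕ} {z : ℕ → ℂ}
    (h : IsFiniteOrbit p q c (m + n) z) : IsFiniteOrbit p q c n fun i => z (m + i) :=
  fun i hi => h (m + i) (by omega)

/-- Following `x` up to time `n`, then `y`. -/
def glue (n : ℕ) (x y : ℕ → ℂ) : ℕ → ℂ := fun i => if i ≤ n then x i else y (i - n)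

theorem glue_of_le {n i : ℕ} (h : i ≤ n) (x y : ℕ → ℂ) : glue n x y i = x i := if_pos h

theorem glue_add {n : ℕ} {x y : ℕ → ℂ} (h : x n = y 0) (i : ℕ) : glue n x y (n + i) = y i := by
  rcases Nat.eq_zero_or_pos i with rfl | hi
  · simp [glue, h]
  · rw [glue, if_neg (by omega)]
    congr 1
    omega

theorem isFiniteOrbit_glue {p q : ℕ} {c : ℂ} {n m : ℕ} {x y : ℕ → ℂ}
    (hx : IsFiniteOrbit p q c n x) (hy : IsFiniteOrbit p q c m y) (h : x n = y 0) :
    IsFiniteOrbit p q c (n + m) (glue n x y) := by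
  intro i hi
  rcases lt_or_ge i n with h1 | h1
  · rw [glue_of_le h1.le, glue_of_le h1]
    exact hx i h1
  · obtain ⟨k, rfl⟩ := Nat.exists_eq_add_of_le h1
    rw [add_assoc, glue_add h, glue_add h]
    exact hy k (by omega)

theorem logExpansionSum_add (p q : ℕ) (z : ℕ → ℂ) (m n : ℕ) :
    logExpansionSum p q z (m + n) =
      logExpansionSum p q z m + logExpansionSum p q (fun i => z (m + i)) n :=
  Finset.sum_range_add _ _ _

theorem logExpansionSum_succ' (p q : ℕ) (z : ℕ → ℂ) (n : ℕ) :
    logExpansionSum p q z (n + 1) =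
      logExpansion p q (z 0) + logExpansionSum p q (fun i => z (i + 1)) n := by
  rw [logExpansionSum, Finset.sum_range_succ', add_comm]; rfl

theorem logExpansionSum_congr {p q : ℕ} {z z' : ℕ → ℂ} {n : ℕ} (h : ∀ i < n, z i = z' i) :
    logExpansionSum p q z n = logExpansionSum p q z' n :=
  Finset.sum_congr rfl fun i hi => by rw [h i (Finset.mem_range.1 hi)]

namespace IsHyperbolicRepeller

variable {p q : ℕ} {c : ℂ} {Λ : Set ℂ}

theorem ne_zero (h : IsHyperbolicRepeller p q c Λ) {z : ℂ} (hz : z ∈ Λ) : z ≠ 0 :=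
  fun h0 => h.zero_notMem (h0 ▸ hz)

theorem mem_of_isImage (h : IsHyperbolicRepeller p q c Λ) {z w : ℂ} (hi : IsImage p q c z w)
    (hw : w ∈ Λ) : z ∈ Λ := by
  rw [← h.preimage_eq]
  exact ⟨w, hw, hi⟩

theorem exists_image_mem (h : IsHyperbolicRepeller p q c Λ) {z : ℂ} (hz : z ∈ Λ) :
    ∃ w ∈ Λ, IsImage p q c z w := by
  rw [← h.preimage_eq] at hz
  exact hz

theorem critical_value_notMem (h : IsHyperbolicRepeller p q c Λ) (hp : p ≠ 0) (hq : q ≠ 0) :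
    c ∉ Λ := fun hc =>
  h.zero_notMem (h.mem_of_isImage (w := c) (by simp [IsImage, hp, hq]) hc)

theorem mem_of_isFiniteOrbit (h : IsHyperbolicRepeller p q c Λ) {n : ℕ} {z : ℕ → ℂ}
    (hz : IsFiniteOrbit p q c n z) (hn : z n ∈ Λ) : ∀ i ≤ n, z i ∈ Λ := by
  induction n with
  | zero => intro i hi; rwa [Nat.le_zero.1 hi]
  | succ n ih =>
    intro i hi
    rcases Nat.lt_or_ge n i with h1 | h1
    · rwa [show i = n + 1 by omega]
    · exact ih (hz.mono (by omega)) (h.mem_of_isImage (hz n (by omega)) hn) i h1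

theorem exists_orbit (h : IsHyperbolicRepeller p q c Λ) {z : ℂ} (hz : z ∈ Λ) :
    ∃ y ∈ orbitSpace p q c Λ, y 0 = z := by
  choose! g hg hgi using fun z (hz : z ∈ Λ) => h.exists_image_mem hz
  have hm : ∀ i, g^[i] z ∈ Λ := by
    intro i
    induction i with
    | zero => exact hz
    | succ i ih => rw [Function.iterate_succ_apply']; exact hg _ ih
  refine ⟨fun i => g^[i] z, fun i => ⟨hm i, ?_⟩, rfl⟩
  simp only [Function.iterate_succ_apply']
  exact hgi _ (hm i)

theorem exists_norm_lower_bound (h : IsHyperbolicRepeller p q c Λ) (hp : p ≠ 0) (hq : q ≠ 0) :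
    ∃ a > (0 : ℝ), ∀ z ∈ Λ, a ≤ ‖z‖ ∧ a ≤ ‖z - c‖ := by
  have hcl := h.isCompact.isClosed.isOpen_compl
  obtain ⟨a, ha, hab⟩ := Metric.isOpen_iff.1 hcl 0 h.zero_notMem
  obtain ⟨b, hb, hbb⟩ := Metric.isOpen_iff.1 hcl c (h.critical_value_notMem hp hq)
  refine ⟨min a b, lt_min ha hb, fun z hz => ⟨?_, ?_⟩⟩
  · by_contra hcon
    exact hab (mem_ball_zero_iff.2 ((not_le.1 hcon).trans_le (min_le_left _ _))) hz
  · by_contra hcon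
    exact hbb (mem_ball_iff_norm.2 ((not_le.1 hcon).trans_le (min_le_right _ _))) hz

theorem exists_logExpansionSum_ge (h : IsHyperbolicRepeller p q c Λ) (hp : p ≠ 0) (hq : q ≠ 0) :
    ∃ κ > (0 : ℝ), ∃ l > (0 : ℝ), ∀ (n : ℕ) (z : ℕ → ℂ), IsFiniteOrbit p q c n z →
      (∀ i ≤ n, z i ∈ Λ) → n * l - κ ≤ logExpansionSum p q z n := by
  obtain ⟨C, hC, l, hl, hexp⟩ := h.expanding
  refine ⟨max 1 (-Real.log C), by positivity, Real.log l, Real.log_pos hl,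
    fun n z hz hm => ?_⟩
  obtain ⟨D, hD, hn⟩ := exists_hasDerivAt_orbitBranch hp hq
    (fun i hi => h.ne_zero (hm i (le_of_lt hi))) hz
  have h1 := hexp n z hz hm
  rw [hD.deriv, hn, ← Real.log_le_iff_le_exp (by positivity),
    Real.log_mul hC.ne' (by positivity), Real.log_pow] at h1
  linarith [le_max_right 1 (-Real.log C)]

/-- Orbits in the repeller can be pulled back from points close to their end. -/
theorem exists_shadowing (h : IsHyperbolicRepeller p q c Λ) (hq : q ≠ 0) (hpq : q ≤ p) :
    ∃ r > (0 : ℝ), ∃ K > (0 : ℝ), ∃ θ > (0 : ℝ), θ < 1 ∧ ∀ (n : ℕ) (z : ℕ → ℂ),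
      IsFiniteOrbit p q c n z → (∀ i ≤ n, z i ∈ Λ) → ∀ w, ‖w - z n‖ ≤ r →
      ∃ x, IsFiniteOrbit p q c n x ∧ x n = w ∧
        (∀ i ≤ n, ‖x i - z i‖ ≤ K * θ ^ (n - i) * ‖w - z n‖) ∧
        ‖x 0 - z 0‖ ≤ K * Real.exp (-logExpansionSum p q z n) * ‖w - z n‖ := by
  have hp : p ≠ 0 := by omega
  obtain ⟨a, ha, hlow⟩ := h.exists_norm_lower_bound hp hq
  obtain ⟨κ, hκ, l, hl, hexp⟩ := h.exists_logExpansionSum_ge hp hq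
  set θ := Real.exp (-l) with hθ
  have hθ0 : 0 < θ := Real.exp_pos _
  have hθ1 : θ < 1 := by rw [hθ, Real.exp_lt_one_iff]; linarith
  set r := min (a / 2) (a / 2 * (1 - θ)) / Real.exp (κ + 1) with hr
  have h1θ : 0 < 1 - θ := by linarith
  have hr0 : 0 < r := by positivity
  have hgeom : ∀ m, (1 - θ) * ∑ j ∈ Finset.range m, θ ^ j ≤ 1 := by
    intro m
    rw [mul_comm, geom_sum_mul_neg]
    linarith [pow_pos hθ0 m]
  have hsum : ∀ (n : ℕ) (z : ℕ → ℂ), IsFiniteOrbit p q c n z → (∀ i ≤ n, z i ∈ Λ) → ∀ i ≤ n,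
      Real.exp (-(logExpansionSum p q z n - logExpansionSum p q z i)) ≤
        Real.exp κ * θ ^ (n - i) := by
    intro n z hz hm i hi
    obtain ⟨m, rfl⟩ := Nat.exists_eq_add_of_le hi
    have := hexp m _ hz.drop fun j hj => hm (i + j) (by omega)
    rw [logExpansionSum_add, Nat.add_sub_cancel_left, hθ, ← Real.exp_nat_mul, ← Real.exp_add,
      Real.exp_le_exp]
    linarith
  have main : ∀ (n : ℕ) (z : ℕ → ℂ), IsFiniteOrbit p q c n z → (∀ i ≤ n, z i ∈ Λ) →
      ∀ w, ‖w - z n‖ ≤ r → ∃ x, IsFiniteOrbit p q c n x ∧ x n = w ∧ ∀ i ≤ n, ‖x i - z i‖ ≤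
        Real.exp (-(logExpansionSum p q z n - logExpansionSum p q z i) +
          (1 - θ) * ∑ j ∈ Finset.range (n - i), θ ^ j) * ‖w - z n‖ := by
    intro n
    induction n with
    | zero =>
      intro z hz hm w hw
      refine ⟨fun _ => w, fun i hi => absurd hi (by omega), rfl, fun i hi => ?_⟩
      rw [Nat.le_zero.1 hi]
      simp
    | succ n ih =>
      intro z hz hm w hw
      have hz' : IsFiniteOrbit p q c n fun i => z (i + 1) := fun i hi => hz (i + 1) (by omega)
      have hm' : ∀ i ≤ n, z (i + 1) ∈ Λ := fun i hi => hm (i + 1) (by omega)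
      obtain ⟨x, hx, hxn, hxe⟩ := ih (fun i => z (i + 1)) hz' hm' w hw
      have he := hxe 0 (Nat.zero_le _)
      simp only [Nat.sub_zero, zero_add] at he
      have he0 : ‖x 0 - z 1‖ ≤ min (a / 2) (a / 2 * (1 - θ)) * θ ^ n := by
        refine he.trans ?_
        have h2 := hsum n _ hz' hm' 0 (Nat.zero_le _)
        rw [Nat.sub_zero] at h2
        calc _ ≤ Real.exp κ * θ ^ n * Real.exp 1 * r := by
              rw [Real.exp_add]
              gcongr
              exact hgeom n
          _ = _ := by
              rw [hr, Real.exp_add]; field_simp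
      have hθn : θ ^ n ≤ 1 := pow_le_one₀ hθ0.le hθ1.le
      have he1 : ‖x 0 - z 1‖ ≤ a / 2 := by
        refine he0.trans ?_
        calc _ ≤ a / 2 * 1 := by gcongr; exact min_le_left _ _
          _ = _ := mul_one _
      have he2 : ‖x 0 - z 1‖ ≤ a / 2 * (1 - θ) * θ ^ n := by
        refine he0.trans ?_
        gcongr
        exact min_le_right _ _
      have hz1 := (hlow _ (hm 1 (by omega))).2
      obtain ⟨x₀, hx₀, hx₀e⟩ := (hz 0 (by omega)).exists_isImage_near hq hpq
        (h.ne_zero (hm 0 (by omega))) (w := x 0) (by rw [zero_add]; linarith)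
      rw [zero_add] at hx₀e
      refine ⟨fun i => Nat.casesOn i x₀ x, ?_, hxn, ?_⟩
      · intro i hi
        cases i with
        | zero => exact hx₀
        | succ i => exact hx i (by omega)
      · intro i hi
        cases i with
        | succ i =>
          have := hxe i (by omega)
          rw [logExpansionSum_succ', logExpansionSum_succ']
          simpa using this
        | zero =>
          have h3 : 1 + 2 / ‖z 1 - c‖ * ‖x 0 - z 1‖ ≤ Real.exp ((1 - θ) * θ ^ n) := by
            have h4 : 2 / ‖z 1 - c‖ * ‖x 0 - z 1‖ ≤ (1 - θ) * θ ^ n :=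
              calc _ ≤ 2 / a * (a / 2 * (1 - θ) * θ ^ n) := by gcongr
                _ = _ := by field_simp
            linarith [Real.add_one_le_exp ((1 - θ) * θ ^ n)]
          simp only [Nat.sub_zero]
          calc ‖x₀ - z 0‖ ≤ _ := hx₀e
            _ ≤ Real.exp (-logExpansion p q (z 0)) * Real.exp ((1 - θ) * θ ^ n) *
                (Real.exp (-(logExpansionSum p q (fun i => z (i + 1)) n -
                  logExpansionSum p q (fun i => z (i + 1)) 0) +
                  (1 - θ) * ∑ j ∈ Finset.range n, θ ^ j) * ‖w - z (n + 1)‖) := by gcongr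
            _ = _ := by
              rw [← mul_assoc, ← Real.exp_add, ← Real.exp_add]
              congr 2
              rw [logExpansionSum_succ', Finset.sum_range_succ]
              simp only [logExpansionSum, Finset.range_zero, Finset.sum_empty]
              ring
  refine ⟨r, hr0, Real.exp (κ + 1), Real.exp_pos _, θ, hθ0, hθ1, fun n z hz hm w hw => ?_⟩
  obtain ⟨x, hx, hxn, hxe⟩ := main n z hz hm w hw
  refine ⟨x, hx, hxn, fun i hi => (hxe i hi).trans ?_, (hxe 0 (Nat.zero_le _)).trans ?_⟩
  · gcongr
    rw [Real.exp_add, Real.exp_add, mul_right_comm]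
    gcongr
    · exact hsum n z hz hm i hi
    · exact hgeom _
  · gcongr
    rw [← Real.exp_add, Real.exp_le_exp]
    have := hgeom (n - 0)
    simp only [logExpansionSum, Finset.range_zero, Finset.sum_empty] at *
    linarith

end IsHyperbolicRepeller

/-- Orbits with a common end that stay relatively close to each other coincide. -/
theorem exists_eq_of_close {p : ℕ} (hp : p ≠ 0) : ∃ κ > (0 : ℝ), ∀ (q : ℕ) (c : ℂ) (n : ℕ)
    (x y : ℕ → ℂ), IsFiniteOrbit p q c n x → IsFiniteOrbit p q c n y → x n = y n →
    (∀ i < n, ‖x i - y i‖ < κ * ‖y i‖) → ∀ i ≤ n, x i = y i := by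
  obtain ⟨κ, hκ, hsep⟩ := exists_root_separation hp
  refine ⟨κ, hκ, fun q c n x y hx hy hn hd => ?_⟩
  induction n with
  | zero => intro i hi; rwa [Nat.le_zero.1 hi]
  | succ n ih =>
    have h1 : x n = y n := by
      refine hsep _ _ ?_ (hd n (by omega))
      rw [← hx n (by omega), ← hy n (by omega), hn]
    intro i hi
    rcases Nat.lt_or_ge n i with h2 | h2
    · rwa [show i = n + 1 by omega]
    · exact ih (hx.mono (by omega)) (hy.mono (by omega)) h1 (fun i hi => hd i (by omega)) i h2

theorem abs_logExpansion_sub_le {p q : ℕ} (hq : q ≠ 0) (hpq : q ≤ p) {a : ℝ} (ha : 0 < a)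
    {x y : ℂ} (hx : a ≤ ‖x‖) (hy : a ≤ ‖y‖) :
    |logExpansion p q x - logExpansion p q y| ≤ ((p : ℝ) / q - 1) / a * ‖x - y‖ := by
  have hα : 0 ≤ (p : ℝ) / q - 1 := by
    rw [sub_nonneg, one_le_div (by positivity)]
    exact_mod_cast hpq
  have key : ∀ u v : ℂ, a ≤ ‖u‖ → a ≤ ‖v‖ → Real.log ‖u‖ - Real.log ‖v‖ ≤ ‖u - v‖ / a := by
    intro u v hu hv
    have hu0 : 0 < ‖u‖ := ha.trans_le hu
    have hv0 : 0 < ‖v‖ := ha.trans_le hv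
    rw [← Real.log_div hu0.ne' hv0.ne']
    refine (Real.log_le_sub_one_of_pos (by positivity)).trans ?_
    rw [div_sub_one hv0.ne']
    calc _ ≤ ‖u - v‖ / ‖v‖ := by gcongr; exact norm_sub_norm_le u v
      _ ≤ _ := by gcongr
  have h1 : |Real.log ‖x‖ - Real.log ‖y‖| ≤ ‖x - y‖ / a := by
    rw [abs_le]
    have := key y x hy hx
    rw [norm_sub_rev] at this
    exact ⟨by linarith, key x y hx hy⟩
  rw [logExpansion, logExpansion, add_sub_add_left_eq_sub, ← mul_sub, abs_mul, abs_of_nonneg hα,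
    div_mul_eq_mul_div, mul_div_assoc]
  gcongr

/-- The finite set of preimages of `w`. -/
def preimageFinset (p q : ℕ) (c w : ℂ) : Finset ℂ := (Polynomial.nthRoots p ((w - c) ^ q)).toFinset

theorem mem_preimageFinset {p q : ℕ} {c w v : ℂ} (hp : p ≠ 0) :
    v ∈ preimageFinset p q c w ↔ IsImage p q c v w := by
  rw [preimageFinset, Multiset.mem_toFinset, Polynomial.mem_nthRoots (Nat.pos_of_ne_zero hp),
    IsImage, eq_comm]

theorem card_preimageFinset_le (p q : ℕ) (c w : ℂ) : (preimageFinset p q c w).card ≤ p :=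
  (Multiset.toFinset_card_le _).trans (Polynomial.card_nthRoots _ _)

theorem preimageFinset_nonempty {p q : ℕ} (c w : ℂ) (hp : p ≠ 0) :
    (preimageFinset p q c w).Nonempty := by
  obtain ⟨v, hv⟩ := IsAlgClosed.exists_pow_nat_eq ((w - c) ^ q) (Nat.pos_of_ne_zero hp)
  exact ⟨v, (mem_preimageFinset hp).2 hv.symm⟩

theorem two_le_card_preimageFinset {p q : ℕ} {c w : ℂ} (hp : 2 ≤ p) (hw : w ≠ c) :
    2 ≤ (preimageFinset p q c w).card := by
  have hp0 : p ≠ 0 := by omega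
  obtain ⟨v, hv⟩ := preimageFinset_nonempty (q := q) c w hp0
  have hv' := (mem_preimageFinset hp0).1 hv
  have hζ := Complex.isPrimitiveRoot_exp p hp0
  set ζ := Complex.exp (2 * Real.pi * Complex.I / p)
  have hv0 : v ≠ 0 := by
    rintro rfl
    unfold IsImage at hv'
    rw [zero_pow hp0] at hv'
    exact pow_ne_zero q (sub_ne_zero.2 hw) hv'
  have h2 : ζ * v ∈ preimageFinset p q c w := by
    rw [mem_preimageFinset hp0, IsImage, mul_pow, hζ.pow_eq_one, one_mul]
    exact hv'
  refine Finset.one_lt_card.2 ⟨v, hv, ζ * v, h2, fun h => hζ.ne_one (by omega) ?_⟩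
  exact mul_right_cancel₀ hv0 (by rw [one_mul, ← h])

/-- The sum of `‖Dg‖^{-s}` over all branches `g` of the `n`-th iterate of the correspondence
ending at `w`. -/
def transferSum (p q : ℕ) (c : ℂ) (s : ℝ) : ℕ → ℂ → ℝ
  | 0, _ => 1
  | n + 1, w => ∑ v ∈ preimageFinset p q c w,
      Real.exp (-s * logExpansion p q v) * transferSum p q c s n v

theorem transferSum_pos {p q : ℕ} {c : ℂ} (hp : p ≠ 0) (s : ℝ) (n : ℕ) (w : ℂ) :
    0 < transferSum p q c s n w := by
  induction n generalizing w with
  | zero => exact one_pos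
  | succ n ih =>
    exact Finset.sum_pos (fun v _ => mul_pos (Real.exp_pos _) (ih v))
      (preimageFinset_nonempty c w hp)

theorem exists_backwardOrbit_enumeration {p q : ℕ} {c : ℂ} (hp : p ≠ 0) (n : ℕ) (w : ℂ) :
    ∃ (ι : Type) (_ : Fintype ι) (Y : ι → ℕ → ℂ),
      (∀ a, IsFiniteOrbit p q c n (Y a) ∧ Y a n = w) ∧
      (∀ a b, (∀ i ≤ n, Y a i = Y b i) → a = b) ∧
      (∀ y, IsFiniteOrbit p q c n y → y n = w → ∃ a, ∀ i ≤ n, Y a i = y i) ∧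
      ∀ s, transferSum p q c s n w = ∑ a, Real.exp (-s * logExpansionSum p q (Y a) n) := by
  induction n generalizing w with
  | zero =>
    refine ⟨Unit, inferInstance, fun _ _ => w, fun _ => ⟨fun i hi => absurd hi (by omega), rfl⟩,
      fun _ _ _ => rfl, fun y _ hy => ⟨(), fun i hi => ?_⟩, fun s => ?_⟩
    · rw [Nat.le_zero.1 hi, hy]
    · simp [transferSum, logExpansionSum]
  | succ n ih =>
    choose ι hι Y hY hinj hsurj hsum using ih
    have hle : ∀ (v : ℂ) (a : ι v) (i), i ≤ n → glue n (Y v a) (fun _ => w) i = Y v a i :=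
      fun v a i hi => glue_of_le hi _ _
    have hlast : ∀ (v : ℂ) (a : ι v), glue n (Y v a) (fun _ => w) (n + 1) = w :=
      fun v a => if_neg (by omega)
    refine ⟨Σ v : preimageFinset p q c w, ι v, inferInstance,
      fun a => glue n (Y a.1 a.2) (fun _ => w), ?_, ?_, ?_, ?_⟩
    · rintro ⟨⟨v, hv⟩, a⟩
      refine ⟨fun i hi => ?_, hlast v a⟩
      simp only
      rcases Nat.lt_succ_iff_lt_or_eq.1 hi with h1 | rfl
      · rw [hle v a i (by omega), hle v a (i + 1) (by omega)]
        exact (hY v a).1 i h1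
      · rw [hle v a i le_rfl, hlast, (hY v a).2]
        exact (mem_preimageFinset hp).1 hv
    · rintro ⟨⟨v, hv⟩, a⟩ ⟨⟨v', hv'⟩, a'⟩ hab
      have h1 : ∀ i ≤ n, Y v a i = Y v' a' i := fun i hi => by
        have := hab i (by omega)
        simp only at this
        rwa [hle v a i hi, hle v' a' i hi] at this
      have h2 : v = v' := by rw [← (hY v a).2, ← (hY v' a').2]; exact h1 n le_rfl
      subst h2
      rw [hinj v a a' h1]
    · intro y hy hyw
      obtain ⟨a, ha⟩ := hsurj (y n) y (hy.mono (by omega)) rfl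
      refine ⟨⟨⟨y n, (mem_preimageFinset hp).2 (hyw ▸ hy n (by omega))⟩, a⟩, fun i hi => ?_⟩
      rcases Nat.lt_or_ge n i with h1 | h1
      · rw [show i = n + 1 by omega]
        exact (hlast (y n) a).trans hyw.symm
      · exact (hle (y n) a i h1).trans (ha i h1)
    · intro s
      rw [transferSum, Fintype.sum_sigma, ← Finset.sum_coe_sort]
      refine Finset.sum_congr rfl fun v _ => ?_
      rw [hsum, Finset.mul_sum]
      refine Finset.sum_congr rfl fun a _ => ?_
      rw [← Real.exp_add, logExpansionSum, logExpansionSum, Finset.sum_range_succ]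
      simp only
      rw [hle v a n le_rfl, (hY v a).2, Finset.sum_congr rfl
        fun i hi => congrArg (logExpansion p q) (hle v a i (Finset.mem_range.1 hi).le)]
      congr 1
      ring

theorem sum_exp_le_transferSum {p q : ℕ} {c : ℂ} (hp : p ≠ 0) (s : ℝ) (n : ℕ) (w : ℂ)
    {α : Type*} (E : Finset α) (W : α → ℕ → ℂ)
    (hW : ∀ a ∈ E, IsFiniteOrbit p q c n (W a) ∧ W a n = w)
    (hinj : ∀ a ∈ E, ∀ b ∈ E, (∀ i ≤ n, W a i = W b i) → a = b) :
    ∑ a ∈ E, Real.exp (-s * logExpansionSum p q (W a) n) ≤ transferSum p q c s n w := by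
  obtain ⟨ι, _, Y, hY, -, hsurj, hsum⟩ := exists_backwardOrbit_enumeration (q := q) (c := c) hp n w
  rw [hsum]
  have hex : ∀ a ∈ E, ∃ b, ∀ i ≤ n, Y b i = W a i := fun a ha => hsurj _ (hW a ha).1 (hW a ha).2
  classical
  by_cases hE : E = ∅
  · rw [hE, Finset.sum_empty]
    exact Finset.sum_nonneg fun _ _ => (Real.exp_pos _).le
  obtain ⟨a₀, ha₀⟩ := Finset.nonempty_iff_ne_empty.2 hE
  have : Nonempty ι := ⟨(hex a₀ ha₀).choose⟩
  choose! b hb using hex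
  have hbinj : Set.InjOn b E := fun a ha a' ha' h => hinj a ha a' ha' fun i hi => by
    rw [← hb a ha i hi, ← hb a' ha' i hi, h]
  calc _ = ∑ a ∈ E, Real.exp (-s * logExpansionSum p q (Y (b a)) n) :=
        Finset.sum_congr rfl fun a ha => by
          rw [logExpansionSum_congr fun i hi => (hb a ha i (le_of_lt hi)).symm]
    _ = ∑ d ∈ E.image b, Real.exp (-s * logExpansionSum p q (Y d) n) :=
        (Finset.sum_image (f := fun d => Real.exp (-s * logExpansionSum p q (Y d) n)) hbinj).symm
    _ ≤ _ := Finset.sum_le_univ_sum_of_nonneg fun _ => (Real.exp_pos _).le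

theorem exp_mul_transferSum_le {p q : ℕ} {c : ℂ} (hp : p ≠ 0) (s : ℝ) (n m : ℕ) {x : ℕ → ℂ}
    (hx : IsFiniteOrbit p q c m x) :
    Real.exp (-s * logExpansionSum p q x m) * transferSum p q c s n (x 0) ≤
      transferSum p q c s (n + m) (x m) := by
  induction m with
  | zero => simp [logExpansionSum]
  | succ m ih =>
    rw [← add_assoc, transferSum]
    refine le_trans ?_ (Finset.single_le_sum (fun v _ => (mul_pos (Real.exp_pos _)
      (transferSum_pos hp s (n + m) v)).le) ((mem_preimageFinset hp).2 (hx m (by omega))))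
    refine le_trans (le_of_eq ?_)
      (mul_le_mul_of_nonneg_left (ih (hx.mono (by omega))) (Real.exp_pos _).le)
    rw [← mul_assoc, ← Real.exp_add, logExpansionSum, logExpansionSum, Finset.sum_range_succ]
    congr 2
    ring

theorem mem_iterate_imageSet {p q : ℕ} {c : ℂ} {A : Set ℂ} {n : ℕ} {w : ℂ}
    (h : w ∈ (imageSet p q c)^[n] A) : ∃ x : ℕ → ℂ, IsFiniteOrbit p q c n x ∧ x 0 ∈ A ∧ x n = w := by
  induction n generalizing w with
  | zero => exact ⟨fun _ => w, fun i hi => absurd hi (by omega), h, rfl⟩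
  | succ n ih =>
    rw [Function.iterate_succ_apply'] at h
    obtain ⟨v, hv, hvw⟩ := h
    obtain ⟨x, hx, hx0, hxn⟩ := ih hv
    refine ⟨glue n x (fun i => if i = 0 then v else w),
      isFiniteOrbit_glue hx (m := 1) (fun i hi => ?_) (by simp [hxn]),
      by rw [glue_of_le (Nat.zero_le _)]; exact hx0, by rw [glue_add (by simp [hxn])]; simp⟩
    obtain rfl : i = 0 := by omega
    simpa using hvw

theorem IsLEO.exists_uniform {p q : ℕ} {c : ℂ} {Λ : Set ℂ} (h : IsLEO p q c Λ)
    (hΛ : IsCompact Λ) {r : ℝ} (hr : 0 < r) : ∃ N : ℕ, ∀ w ∈ Λ, ∀ w' ∈ Λ,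
      ∃ m ≤ N, ∃ x, IsFiniteOrbit p q c m x ∧ x 0 ∈ Λ ∧ ‖x 0 - w‖ ≤ r ∧ x m = w' := by
  have : ∀ u ∈ Λ, ∃ m, Λ ⊆ (imageSet p q c)^[m] (Metric.ball u (r / 2) ∩ Λ) := fun u hu => by
    obtain ⟨m, -, hm⟩ := h _ Metric.isOpen_ball ⟨u, Metric.mem_ball_self (half_pos hr), hu⟩
    exact ⟨m, hm⟩
  choose! m hm using this
  obtain ⟨t, ht, htf, hcov⟩ := hΛ.finite_cover_balls (half_pos hr)
  refine ⟨htf.toFinset.sup m, fun w hw w' hw' => ?_⟩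
  obtain ⟨u, hu, hwu⟩ := Set.mem_iUnion₂.1 (hcov hw)
  obtain ⟨x, hx, hx0, hxm⟩ := mem_iterate_imageSet (hm u (ht hu) hw')
  refine ⟨m u, Finset.le_sup (f := m) (htf.mem_toFinset.2 hu), x, hx, hx0.2, ?_, hxm⟩
  have h1 := Metric.mem_ball.1 hx0.1
  have h2 := Metric.mem_ball.1 hwu
  rw [← dist_eq_norm]
  linarith [dist_triangle_right (x 0) w u]

theorem abs_logExpansionSum_le {p q : ℕ} {Λ : Set ℂ} {M : ℝ}
    (hM : ∀ z ∈ Λ, |logExpansion p q z| ≤ M) {n : ℕ} {z : ℕ → ℂ}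
    (hz : ∀ i < n, z i ∈ Λ) : |logExpansionSum p q z n| ≤ n * M := by
  refine (Finset.abs_sum_le_sum_abs _ _).trans ?_
  refine (Finset.sum_le_sum fun i hi => hM _ (hz i (Finset.mem_range.1 hi))).trans ?_
  simp

namespace IsHyperbolicRepeller

variable {p q : ℕ} {c : ℂ} {Λ : Set ℂ}

theorem exists_abs_logExpansion_le (h : IsHyperbolicRepeller p q c Λ) :
    ∃ M > (0 : ℝ), ∀ z ∈ Λ, |logExpansion p q z| ≤ M := by
  have hcont : ContinuousOn (logExpansion p q) Λ := by
    unfold logExpansion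
    refine continuousOn_const.add (continuousOn_const.mul (ContinuousOn.log
      continuous_norm.continuousOn fun z hz => norm_ne_zero_iff.2 (h.ne_zero hz)))
  obtain ⟨M, hM⟩ := h.isCompact.exists_bound_of_continuousOn hcont
  exact ⟨max M 1, by positivity, fun z hz => (hM z hz).trans (le_max_left _ _)⟩

theorem exists_logExpansionSum_distortion (h : IsHyperbolicRepeller p q c Λ) (hq : q ≠ 0)
    (hpq : q ≤ p) {B θ : ℝ} (hB : 0 ≤ B) (hθ : 0 ≤ θ) (hθ1 : θ < 1) :
    ∃ k ≥ (0 : ℝ), ∀ (n : ℕ) (x z : ℕ → ℂ), (∀ i < n, x i ∈ Λ) → (∀ i < n, z i ∈ Λ) →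
      (∀ i < n, ‖x i - z i‖ ≤ B * θ ^ (n - i)) →
      |logExpansionSum p q x n - logExpansionSum p q z n| ≤ k := by
  obtain ⟨a, ha, hlow⟩ := h.exists_norm_lower_bound (by omega) hq
  have hα : 0 ≤ (p : ℝ) / q - 1 := by
    rw [sub_nonneg, one_le_div (by positivity)]
    exact_mod_cast hpq
  have h1θ : 0 < 1 - θ := by linarith
  refine ⟨((p : ℝ) / q - 1) / a * B * (1 / (1 - θ)), by positivity, fun n x z hx hz hd => ?_⟩
  rw [logExpansionSum, logExpansionSum, ← Finset.sum_sub_distrib]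
  refine (Finset.abs_sum_le_sum_abs _ _).trans ?_
  calc _ ≤ ∑ i ∈ Finset.range n, ((p : ℝ) / q - 1) / a * B * θ ^ (n - 1 - i) := by
        refine Finset.sum_le_sum fun i hi => ?_
        have hi' := Finset.mem_range.1 hi
        refine (abs_logExpansion_sub_le hq hpq ha (hlow _ (hx i hi')).1
          (hlow _ (hz i hi')).1).trans ?_
        rw [mul_assoc _ B]
        refine mul_le_mul_of_nonneg_left ((hd i hi').trans ?_) (by positivity)
        refine mul_le_mul_of_nonneg_left ?_ hB
        exact pow_le_pow_of_le_one hθ hθ1.le (by omega)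
    _ = ((p : ℝ) / q - 1) / a * B * ∑ i ∈ Finset.range n, θ ^ i := by
        rw [← Finset.mul_sum, Finset.sum_range_reflect (fun i => θ ^ i) n]
    _ ≤ _ := by
        refine mul_le_mul_of_nonneg_left ?_ (by positivity)
        rw [le_div_iff₀ h1θ, geom_sum_mul_neg]
        linarith [pow_nonneg hθ n]

/-- Shadowing inside the repeller, with bounded distortion. -/
theorem exists_shadowing_mem (h : IsHyperbolicRepeller p q c Λ) (hq : q ≠ 0) (hpq : q ≤ p) :
    ∃ r > (0 : ℝ), ∃ K > (0 : ℝ), ∃ θ > (0 : ℝ), ∃ k ≥ (0 : ℝ), θ < 1 ∧ ∀ (n : ℕ) (z : ℕ → ℂ),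
      IsFiniteOrbit p q c n z → (∀ i ≤ n, z i ∈ Λ) → ∀ w ∈ Λ, ‖w - z n‖ ≤ r →
      ∃ x, IsFiniteOrbit p q c n x ∧ x n = w ∧ (∀ i ≤ n, x i ∈ Λ) ∧
        (∀ i ≤ n, ‖x i - z i‖ ≤ K * θ ^ (n - i) * ‖w - z n‖) ∧
        |logExpansionSum p q x n - logExpansionSum p q z n| ≤ k ∧
        ‖x 0 - z 0‖ ≤ K * Real.exp (-logExpansionSum p q z n) * ‖w - z n‖ := by
  obtain ⟨r, hr, K, hK, θ, hθ, hθ1, hsh⟩ := h.exists_shadowing hq hpq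
  obtain ⟨k, hk, hdist⟩ := h.exists_logExpansionSum_distortion hq hpq (B := K * r) (by positivity)
    hθ.le hθ1
  refine ⟨r, hr, K, hK, θ, hθ, k, hk, hθ1, fun n z hz hzm w hw hwr => ?_⟩
  obtain ⟨x, hx, hxn, hxe, hx0⟩ := hsh n z hz hzm w hwr
  have hxm := h.mem_of_isFiniteOrbit hx (hxn ▸ hw)
  refine ⟨x, hx, hxn, hxm, hxe, hdist n x z (fun i hi => hxm i hi.le) (fun i hi => hzm i hi.le)
    fun i hi => (hxe i hi.le).trans ?_, hx0⟩
  rw [mul_right_comm]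
  gcongr

theorem exists_eq_of_close (h : IsHyperbolicRepeller p q c Λ) (hp : p ≠ 0) (hq : q ≠ 0) :
    ∃ δ > (0 : ℝ), ∀ (n : ℕ) (x y : ℕ → ℂ), IsFiniteOrbit p q c n x → IsFiniteOrbit p q c n y →
      (∀ i ≤ n, y i ∈ Λ) → x n = y n → (∀ i < n, ‖x i - y i‖ < δ) → ∀ i ≤ n, x i = y i := by
  obtain ⟨κ, hκ, hsep⟩ := Corr.exists_eq_of_close hp
  obtain ⟨a, ha, hlow⟩ := h.exists_norm_lower_bound hp hq
  refine ⟨κ * a, by positivity, fun n x y hx hy hym hn hd => hsep q c n x y hx hy hn fun i hi =>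
    (hd i hi).trans_le ?_⟩
  gcongr
  exact (hlow _ (hym i hi.le)).1

theorem exists_transferSum_le_of_close (h : IsHyperbolicRepeller p q c Λ) (hq : q ≠ 0)
    (hpq : q ≤ p) : ∃ r > (0 : ℝ), ∃ k ≥ (0 : ℝ), ∀ s n, ∀ w ∈ Λ, ∀ w' ∈ Λ, ‖w' - w‖ ≤ r →
      transferSum p q c s n w ≤ Real.exp (|s| * k) * transferSum p q c s n w' := by
  have hp : p ≠ 0 := by omega
  obtain ⟨r, hr, K, hK, θ, hθ, k, hk, hθ1, hsh⟩ := h.exists_shadowing_mem hq hpq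
  obtain ⟨δ, hδ, huniq⟩ := h.exists_eq_of_close hp hq
  refine ⟨min r (δ / (4 * K)), by positivity, k, hk, fun s n w hw w' hw' hww => ?_⟩
  obtain ⟨ι, _, Y, hY, hinj, -, hsum⟩ := exists_backwardOrbit_enumeration (q := q) (c := c) hp n w
  have hYm : ∀ a, ∀ i ≤ n, Y a i ∈ Λ := fun a =>
    h.mem_of_isFiniteOrbit (hY a).1 ((hY a).2 ▸ hw)
  have hex := fun a => hsh n (Y a) (hY a).1 (hYm a) w' hw'
    (by rw [(hY a).2]; exact hww.trans (min_le_left _ _))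
  choose x hx hxn hxm hxe hxk _ using hex
  have hclose : ∀ a, ∀ i ≤ n, ‖x a i - Y a i‖ ≤ δ / 4 := fun a i hi => by
    refine (hxe a i hi).trans ?_
    rw [(hY a).2]
    calc K * θ ^ (n - i) * ‖w' - w‖ ≤ K * 1 * (δ / (4 * K)) := by
          gcongr
          · exact pow_le_one₀ hθ.le hθ1.le
          · exact hww.trans (min_le_right _ _)
      _ = _ := by field_simp
  have key := sum_exp_le_transferSum (q := q) (c := c) hp s n w' Finset.univ x
    (fun a _ => ⟨hx a, hxn a⟩) fun a _ b _ hab => hinj a b <|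
      huniq n _ _ (hY a).1 (hY b).1 (hYm b) (by rw [(hY a).2, (hY b).2]) fun i hi => by
        have h1 := hclose a i hi.le
        have h2 := hclose b i hi.le
        rw [← hab i hi.le] at h2
        rw [norm_sub_rev] at h1
        have := norm_sub_le_norm_sub_add_norm_sub (Y a i) (x a i) (Y b i)
        linarith
  rw [hsum]
  refine le_trans ?_ (mul_le_mul_of_nonneg_left key (Real.exp_pos _).le)
  rw [Finset.mul_sum]
  refine Finset.sum_le_sum fun a _ => ?_
  rw [← Real.exp_add, Real.exp_le_exp]
  have h1 : |s * (logExpansionSum p q (x a) n - logExpansionSum p q (Y a) n)| ≤ |s| * k := by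
    rw [abs_mul]
    exact mul_le_mul_of_nonneg_left (hxk a) (abs_nonneg s)
  linarith [le_abs_self (s * (logExpansionSum p q (x a) n - logExpansionSum p q (Y a) n))]

theorem transferSum_add_le (h : IsHyperbolicRepeller p q c Λ) (hp : p ≠ 0) {s B : ℝ} {m : ℕ}
    (hB : ∀ v ∈ Λ, transferSum p q c s m v ≤ B) (n : ℕ) {w : ℂ} (hw : w ∈ Λ) :
    transferSum p q c s (n + m) w ≤ B * transferSum p q c s n w := by
  induction n generalizing w with
  | zero => simpa [transferSum] using hB w hw
  | succ n ih =>
    rw [add_right_comm, transferSum, transferSum, Finset.mul_sum]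
    refine Finset.sum_le_sum fun v hv => ?_
    rw [mul_left_comm]
    exact mul_le_mul_of_nonneg_left (ih (h.mem_of_isImage ((mem_preimageFinset hp).1 hv) hw))
      (Real.exp_pos _).le

theorem le_transferSum_add (h : IsHyperbolicRepeller p q c Λ) (hp : p ≠ 0) {s B : ℝ} {m : ℕ}
    (hB : ∀ v ∈ Λ, B ≤ transferSum p q c s m v) (n : ℕ) {w : ℂ} (hw : w ∈ Λ) :
    B * transferSum p q c s n w ≤ transferSum p q c s (n + m) w := by
  induction n generalizing w with
  | zero => simpa [transferSum] using hB w hw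
  | succ n ih =>
    rw [add_right_comm, transferSum, transferSum, Finset.mul_sum]
    refine Finset.sum_le_sum fun v hv => ?_
    rw [mul_left_comm]
    exact mul_le_mul_of_nonneg_left (ih (h.mem_of_isImage ((mem_preimageFinset hp).1 hv) hw))
      (Real.exp_pos _).le

theorem exists_transferSum_le_pow (h : IsHyperbolicRepeller p q c Λ) (hq : q ≠ 0) (hpq : q ≤ p)
    (s : ℝ) : ∃ B ≥ (1 : ℝ), ∀ n, ∀ w ∈ Λ, transferSum p q c s n w ≤ B ^ n := by
  have hp : p ≠ 0 := by omega
  obtain ⟨M, hM, hbound⟩ := h.exists_abs_logExpansion_le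
  refine ⟨p * Real.exp (|s| * M), ?_, fun n => ?_⟩
  · have h1 : (1 : ℝ) ≤ p := by exact_mod_cast Nat.one_le_iff_ne_zero.2 hp
    have h2 : 1 ≤ Real.exp (|s| * M) := Real.one_le_exp (by positivity)
    nlinarith
  · induction n with
    | zero => intro w _; simp [transferSum]
    | succ n ih =>
      intro w hw
      rw [transferSum]
      calc _ ≤ ∑ v ∈ preimageFinset p q c w,
            Real.exp (|s| * M) * (p * Real.exp (|s| * M)) ^ n := by
            refine Finset.sum_le_sum fun v hv => ?_
            have hv' := h.mem_of_isImage ((mem_preimageFinset hp).1 hv) hw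
            have h1 : |s * logExpansion p q v| ≤ |s| * M := by
              rw [abs_mul]
              exact mul_le_mul_of_nonneg_left (hbound v hv') (abs_nonneg s)
            have h2 := ih v hv'
            have h3 := (transferSum_pos (q := q) (c := c) hp s n v).le
            have h4 := neg_abs_le (s * logExpansion p q v)
            exact mul_le_mul (Real.exp_le_exp.2 (by linarith)) h2 h3 (Real.exp_pos _).le
        _ ≤ p * (Real.exp (|s| * M) * (p * Real.exp (|s| * M)) ^ n) := by
            rw [Finset.sum_const, nsmul_eq_mul]
            gcongr
            exact_mod_cast card_preimageFinset_le p q c w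
        _ = _ := by ring

theorem exists_transferSum_comparable (h : IsHyperbolicRepeller p q c Λ) (hLEO : IsLEO p q c Λ)
    (hq : q ≠ 0) (hpq : q ≤ p) (s : ℝ) : ∃ C ≥ (1 : ℝ), ∀ n, ∀ w ∈ Λ, ∀ w' ∈ Λ,
      transferSum p q c s n w ≤ C * transferSum p q c s n w' := by
  have hp : p ≠ 0 := by omega
  obtain ⟨r, hr, k, hk, hclose⟩ := h.exists_transferSum_le_of_close hq hpq
  obtain ⟨N, hN⟩ := hLEO.exists_uniform h.isCompact hr
  obtain ⟨M, hM, hbound⟩ := h.exists_abs_logExpansion_le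
  obtain ⟨B, hB, hBn⟩ := h.exists_transferSum_le_pow hq hpq s
  refine ⟨Real.exp (|s| * k) * (Real.exp (|s| * (N * M)) * B ^ N), ?_, fun n w hw w' hw' => ?_⟩
  · refine one_le_mul_of_one_le_of_one_le (Real.one_le_exp (by positivity))
      (one_le_mul_of_one_le_of_one_le (Real.one_le_exp (by positivity)) (one_le_pow₀ hB))
  obtain ⟨m, hm, x, hx, hx0, hxw, hxm⟩ := hN w hw w' hw'
  have hmem := h.mem_of_isFiniteOrbit hx (hxm ▸ hw')
  have h1 := hclose s n w hw (x 0) hx0 hxw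
  have h2 := exp_mul_transferSum_le hp s n m hx
  have h3 := h.transferSum_add_le hp (hBn m) n (hxm ▸ hw')
  have h4 : B ^ m ≤ B ^ N := pow_le_pow_right₀ hB hm
  have h5 : Real.exp (-(|s| * (N * M))) ≤ Real.exp (-s * logExpansionSum p q x m) := by
    rw [Real.exp_le_exp]
    have h6 : |s * logExpansionSum p q x m| ≤ |s| * (N * M) := by
      rw [abs_mul]
      refine mul_le_mul_of_nonneg_left ?_ (abs_nonneg s)
      refine (abs_logExpansionSum_le hbound fun i hi => hmem i hi.le).trans ?_
      gcongr
    linarith [le_abs_self (s * logExpansionSum p q x m)]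
  have h0 := transferSum_pos (q := q) (c := c) hp s n (x 0)
  have h0' := transferSum_pos (q := q) (c := c) hp s n w'
  rw [mul_assoc, mul_assoc]
  refine h1.trans (mul_le_mul_of_nonneg_left ?_ (Real.exp_pos _).le)
  have h7 : Real.exp (-(|s| * (N * M))) * transferSum p q c s n (x 0) ≤
      B ^ N * transferSum p q c s n w' := by
    calc _ ≤ _ := mul_le_mul_of_nonneg_right h5 h0.le
      _ ≤ _ := h2
      _ ≤ _ := h3
      _ ≤ _ := by rw [hxm]; gcongr
  rw [Real.exp_neg, inv_mul_le_iff₀ (Real.exp_pos _)] at h7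
  exact h7

end IsHyperbolicRepeller

/-- A sequence that is additive up to a bounded error grows linearly up to a bounded error. -/
theorem exists_linear_growth {a : ℕ → ℝ} {k : ℝ} (hk : 0 ≤ k)
    (h : ∀ m n, |a (m + n) - a m - a n| ≤ k) : ∃ P : ℝ, ∀ n : ℕ, |a n - n * P| ≤ k := by
  have h0 : |a 0| ≤ k := by simpa using h 0 0
  have hsub : Subadditive fun n => a n + k := fun m n => by
    linarith [(abs_le.1 (h m n)).2]
  have hsup : Subadditive fun n => k - a n := fun m n => by
    linarith [(abs_le.1 (h m n)).1]
  have hlin : ∀ n : ℕ, |a n| ≤ n * (|a 1| + k) + k := by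
    intro n
    induction n with
    | zero => simpa using h0
    | succ n ih =>
      have h1 := abs_le.1 (h n 1)
      have h2 := abs_le.1 ih
      have h3 := neg_abs_le (a 1)
      have h4 := le_abs_self (a 1)
      push_cast
      rw [abs_le]
      constructor <;> linarith
  have hdiv : ∀ n : ℕ, |a n / n| ≤ |a 1| + 2 * k := by
    intro n
    rcases Nat.eq_zero_or_pos n with rfl | hn
    · simp; positivity
    · have hn' : (1 : ℝ) ≤ n := by exact_mod_cast hn
      rw [abs_div, Nat.abs_cast, div_le_iff₀ (by linarith)]
      nlinarith [hlin n]
  have hbound : ∀ n : ℕ, k / n ≤ k ∧ 0 ≤ k / n := fun n => by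
    refine ⟨?_, by positivity⟩
    rcases Nat.eq_zero_or_pos n with rfl | hn
    · simpa using hk
    · exact div_le_self hk (by exact_mod_cast hn)
  have hbb1 : BddBelow (Set.range fun n : ℕ => (a n + k) / n) := by
    refine ⟨-(|a 1| + 2 * k), ?_⟩
    rintro _ ⟨n, rfl⟩
    simp only [add_div]
    linarith [(abs_le.1 (hdiv n)).1, (hbound n).2]
  have hbb2 : BddBelow (Set.range fun n : ℕ => (k - a n) / n) := by
    refine ⟨-(|a 1| + 2 * k), ?_⟩
    rintro _ ⟨n, rfl⟩
    simp only [sub_div]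
    linarith [(abs_le.1 (hdiv n)).2, (hbound n).2]
  have ht1 := hsub.tendsto_lim hbb1
  have ht2 := hsup.tendsto_lim hbb2
  have hsum : hsub.lim + hsup.lim = 0 := by
    refine tendsto_nhds_unique (ht1.add ht2) ?_
    refine (tendsto_const_div_atTop_nhds_zero_nat (2 * k)).congr fun n => ?_
    ring
  refine ⟨hsub.lim, fun n => ?_⟩
  rcases Nat.eq_zero_or_pos n with rfl | hn
  · simpa using h0
  · have h1 := hsub.lim_le_div hbb1 hn.ne'
    have h2 := hsup.lim_le_div hbb2 hn.ne'
    have hn' : (0 : ℝ) < n := by exact_mod_cast hn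
    rw [le_div_iff₀ hn'] at h1 h2
    rw [show hsup.lim = -hsub.lim by linarith] at h2
    rw [abs_le]
    constructor <;> linarith

theorem le_of_forall_nat_mul_le {x y k : ℝ} (h : ∀ n : ℕ, n * x ≤ n * y + k) : x ≤ y := by
  by_contra hcon
  obtain ⟨n, hn⟩ := exists_nat_gt (k / (x - y))
  rw [div_lt_iff₀ (by linarith)] at hn
  linarith [h n]

namespace IsHyperbolicRepeller

variable {p q : ℕ} {c : ℂ} {Λ : Set ℂ}

theorem exists_pressureFunction (h : IsHyperbolicRepeller p q c Λ) (hLEO : IsLEO p q c Λ)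
    (hne : Λ.Nonempty) (hq : q ≠ 0) (hpq : q ≤ p) : ∃ P : ℝ → ℝ, ∀ s, ∃ k, ∀ n : ℕ, ∀ w ∈ Λ,
      Real.exp (n * P s - k) ≤ transferSum p q c s n w ∧
        transferSum p q c s n w ≤ Real.exp (n * P s + k) := by
  have hp : p ≠ 0 := by omega
  obtain ⟨w₀, hw₀⟩ := hne
  have hex : ∀ s, ∃ P k : ℝ, ∀ n : ℕ, ∀ w ∈ Λ, Real.exp (n * P - k) ≤ transferSum p q c s n w ∧
      transferSum p q c s n w ≤ Real.exp (n * P + k) := by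
    intro s
    obtain ⟨C, hC, hcomp⟩ := h.exists_transferSum_comparable hLEO hq hpq s
    have hC0 : 0 < C := by linarith
    have hpos := fun n => transferSum_pos (q := q) (c := c) hp s n w₀
    have hadd : ∀ m n, |Real.log (transferSum p q c s (m + n) w₀) -
        Real.log (transferSum p q c s m w₀) - Real.log (transferSum p q c s n w₀)| ≤
          Real.log C := by
      intro m n
      have h1 := h.transferSum_add_le hp (fun v hv => hcomp n v hv w₀ hw₀) m hw₀
      have h2 := h.le_transferSum_add hp (B := C⁻¹ * transferSum p q c s n w₀) (fun v hv => by
        rw [inv_mul_le_iff₀ hC0]; exact hcomp n w₀ hw₀ v hv) m hw₀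
      have h3 := Real.log_le_log (hpos _) h1
      have hCn := mul_pos hC0 (hpos n)
      have hCn' := mul_pos (inv_pos.2 hC0) (hpos n)
      have h4 := Real.log_le_log (mul_pos hCn' (hpos m)) h2
      rw [Real.log_mul hCn.ne' (hpos m).ne', Real.log_mul hC0.ne' (hpos n).ne'] at h3
      rw [Real.log_mul hCn'.ne' (hpos m).ne', Real.log_mul (inv_pos.2 hC0).ne' (hpos n).ne',
        Real.log_inv] at h4
      rw [abs_le]
      constructor <;> linarith
    obtain ⟨P, hP⟩ := exists_linear_growth (a := fun n => Real.log (transferSum p q c s n w₀))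
      (Real.log_nonneg hC) hadd
    refine ⟨P, 2 * Real.log C, fun n w hw => ?_⟩
    have hposw := transferSum_pos (q := q) (c := c) hp s n w
    have h1 := Real.log_le_log (hpos n) (hcomp n w₀ hw₀ w hw)
    have h2 := Real.log_le_log hposw (hcomp n w hw w₀ hw₀)
    rw [Real.log_mul hC0.ne' hposw.ne'] at h1
    rw [Real.log_mul hC0.ne' (hpos n).ne'] at h2
    have h3 := abs_le.1 (hP n)
    rw [← Real.le_log_iff_exp_le hposw, ← Real.log_le_iff_le_exp hposw]
    constructor <;> linarith
  choose P k hPk using hex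
  exact ⟨P, fun s => ⟨k s, hPk s⟩⟩

theorem exists_pressureFunction_zero (h : IsHyperbolicRepeller p q c Λ) (hne : Λ.Nonempty)
    (hq : q ≠ 0) (hpq : q < p) {P : ℝ → ℝ} (hP : ∀ s, ∃ k, ∀ n : ℕ, ∀ w ∈ Λ,
      Real.exp (n * P s - k) ≤ transferSum p q c s n w ∧
        transferSum p q c s n w ≤ Real.exp (n * P s + k)) :
    ∃ t > 0, ∀ s, P s = 0 ↔ s = t := by
  have hp : p ≠ 0 := by omega
  obtain ⟨w₀, hw₀⟩ := hne
  obtain ⟨M, hM, hbound⟩ := h.exists_abs_logExpansion_le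
  obtain ⟨κ, hκ, l, hl, hexp⟩ := h.exists_logExpansionSum_ge hp hq
  have hupper : ∀ s t, s ≤ t → P t ≤ P s - (t - s) * l := by
    intro s t hst
    obtain ⟨k₁, h₁⟩ := hP s
    obtain ⟨k₂, h₂⟩ := hP t
    refine le_of_forall_nat_mul_le (k := k₁ + k₂ + (t - s) * κ) fun n => ?_
    obtain ⟨ι, _, Y, hY, -, -, hsum⟩ :=
      exists_backwardOrbit_enumeration (q := q) (c := c) hp n w₀
    have h3 : transferSum p q c t n w₀ ≤
        Real.exp (-(t - s) * (n * l - κ)) * transferSum p q c s n w₀ := by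
      rw [hsum, hsum, Finset.mul_sum]
      refine Finset.sum_le_sum fun a _ => ?_
      rw [← Real.exp_add, Real.exp_le_exp]
      have := hexp n (Y a) (hY a).1 (h.mem_of_isFiniteOrbit (hY a).1 ((hY a).2 ▸ hw₀))
      nlinarith
    have h4 := (h₂ n w₀ hw₀).1.trans (h3.trans (mul_le_mul_of_nonneg_left (h₁ n w₀ hw₀).2
      (Real.exp_pos _).le))
    rw [← Real.exp_add, Real.exp_le_exp] at h4
    linarith
  have hlower : ∀ s t, s ≤ t → P s - (t - s) * M ≤ P t := by
    intro s t hst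
    obtain ⟨k₁, h₁⟩ := hP s
    obtain ⟨k₂, h₂⟩ := hP t
    refine le_of_forall_nat_mul_le (k := k₁ + k₂) fun n => ?_
    obtain ⟨ι, _, Y, hY, -, -, hsum⟩ :=
      exists_backwardOrbit_enumeration (q := q) (c := c) hp n w₀
    have h3 : Real.exp (-(t - s) * (n * M)) * transferSum p q c s n w₀ ≤
        transferSum p q c t n w₀ := by
      rw [hsum, hsum, Finset.mul_sum]
      refine Finset.sum_le_sum fun a _ => ?_
      rw [← Real.exp_add, Real.exp_le_exp]
      have hm := h.mem_of_isFiniteOrbit (hY a).1 ((hY a).2 ▸ hw₀)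
      have := (abs_le.1 (abs_logExpansionSum_le hbound fun i (hi : i < n) => hm i hi.le)).2
      nlinarith
    have h4 := (mul_le_mul_of_nonneg_left (h₁ n w₀ hw₀).1 (Real.exp_pos _).le).trans
      (h3.trans (h₂ n w₀ hw₀).2)
    rw [← Real.exp_add, Real.exp_le_exp] at h4
    linarith
  have hzero : 0 < P 0 := by
    obtain ⟨k, hk⟩ := hP 0
    have h1 : ∀ n : ℕ, ∀ w ∈ Λ, (2 : ℝ) ^ n ≤ transferSum p q c 0 n w := by
      intro n
      induction n with
      | zero => intro w _; simp [transferSum]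
      | succ n ih =>
        intro w hw
        rw [transferSum]
        calc (2 : ℝ) ^ (n + 1) = (2 : ℕ) * 2 ^ n := by push_cast; ring
          _ ≤ (preimageFinset p q c w).card * 2 ^ n := by
              gcongr
              exact two_le_card_preimageFinset (by omega) fun hwc =>
                h.critical_value_notMem hp hq (hwc ▸ hw)
          _ = ∑ v ∈ preimageFinset p q c w, (2 : ℝ) ^ n := by simp
          _ ≤ _ := Finset.sum_le_sum fun v hv => by
              simpa using ih v (h.mem_of_isImage ((mem_preimageFinset hp).1 hv) hw)
    refine (Real.log_pos one_lt_two).trans_le (le_of_forall_nat_mul_le (k := k) fun n => ?_)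
    have h2 := (h1 n w₀ hw₀).trans (hk n w₀ hw₀).2
    rw [← Real.log_le_iff_le_exp (by positivity), Real.log_pow] at h2
    exact h2
  have hanti : StrictAnti P := fun s t hst => by
    have := hupper s t hst.le
    nlinarith [mul_pos (sub_pos.2 hst) hl]
  have hcont : Continuous P := by
    have hlip : LipschitzWith (Real.toNNReal M) P := by
      refine LipschitzWith.of_dist_le_mul fun s t => ?_
      rw [Real.coe_toNNReal _ hM.le, Real.dist_eq, Real.dist_eq]
      rcases le_total s t with hst | hst
      · rw [abs_sub_comm s t, abs_of_nonneg (sub_nonneg.2 hst),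
          abs_of_nonneg (sub_nonneg.2 (hanti.antitone hst))]
        linarith [hlower s t hst]
      · rw [abs_of_nonneg (sub_nonneg.2 hst), abs_sub_comm,
          abs_of_nonneg (sub_nonneg.2 (hanti.antitone hst))]
        linarith [hlower t s hst]
    exact hlip.continuous
  have hneg : P (P 0 / l) ≤ 0 := by
    have := hupper 0 (P 0 / l) (by positivity)
    rw [sub_zero, div_mul_cancel₀ _ hl.ne'] at this
    linarith
  obtain ⟨t, ht, htP⟩ := intermediate_value_Icc' (by positivity : 0 ≤ P 0 / l)
    hcont.continuousOn ⟨hneg, hzero.le⟩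
  refine ⟨t, lt_of_le_of_ne ht.1 fun h0 => ?_, fun s => ⟨fun hs => ?_, fun hs => hs ▸ htP⟩⟩
  · rw [← h0] at htP
    linarith
  · exact hanti.injective (hs.trans htP.symm)

end IsHyperbolicRepeller

namespace IsHyperbolicRepeller

variable {p q : ℕ} {c : ℂ} {Λ : Set ℂ}

theorem hausdorffMeasure_lt_top (h : IsHyperbolicRepeller p q c Λ) (hq : q ≠ 0) (hpq : q ≤ p)
    {t B : ℝ} (ht : 0 ≤ t) (hB : ∀ n, ∀ w ∈ Λ, transferSum p q c t n w ≤ B) :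
    Measure.hausdorffMeasure t Λ < ⊤ := by
  have hp : p ≠ 0 := by omega
  obtain ⟨r, hr, K, hK, θ, hθ, k, hk, hθ1, hsh⟩ := h.exists_shadowing_mem hq hpq
  obtain ⟨κ, hκ, l, hl, hexp⟩ := h.exists_logExpansionSum_ge hp hq
  obtain ⟨T, hT, hTf, hcov⟩ := h.isCompact.finite_cover_balls hr
  choose ι hι Y hY hinj hsurj hsum using
    fun n w => exists_backwardOrbit_enumeration (q := q) (c := c) hp n w
  set D := K * Real.exp k * r with hD
  have hD0 : 0 < D := by positivity
  let rad : (n : ℕ) → (Σ w : hTf.toFinset, ι n w) → ℝ := fun n a =>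
    D * Real.exp (-logExpansionSum p q (Y n a.1 a.2) n)
  have hrad0 : ∀ n a, 0 < rad n a := fun n a => by positivity
  have hYm : ∀ n (a : Σ w : hTf.toFinset, ι n w), ∀ i ≤ n, Y n a.1 a.2 i ∈ Λ := fun n a =>
    h.mem_of_isFiniteOrbit (hY n a.1 a.2).1
      (by rw [(hY n a.1 a.2).2]; exact hT (hTf.mem_toFinset.1 a.1.2))
  have hdiam : ∀ n a, Metric.ediam (Metric.closedBall (Y n a.1 a.2 0) (rad n a)) ≤
      ENNReal.ofReal (2 * rad n a) := by
    intro n a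
    refine Metric.ediam_le fun x hx y hy => ?_
    rw [edist_dist]
    refine ENNReal.ofReal_le_ofReal ?_
    linarith [dist_triangle_right x y (Y n a.1 a.2 0), Metric.mem_closedBall.1 hx,
      Metric.mem_closedBall.1 hy]
  have hlim : Tendsto (fun n : ℕ => ENNReal.ofReal (2 * (D * Real.exp (-(n * l - κ))))) atTop
      (𝓝 0) := by
    rw [← ENNReal.ofReal_zero]
    refine ENNReal.tendsto_ofReal ?_
    rw [show (0 : ℝ) = 2 * (D * 0) by ring]
    refine (Tendsto.const_mul _ (Tendsto.const_mul _ ?_))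
    refine Real.tendsto_exp_atBot.comp (tendsto_neg_atTop_atBot.comp ?_)
    exact tendsto_atTop_add_const_right _ _ (tendsto_natCast_atTop_atTop.atTop_mul_const hl)
  have key := Measure.hausdorffMeasure_le_liminf_sum (ι := fun n => Σ w : hTf.toFinset, ι n w) t Λ
    (fun n : ℕ => ENNReal.ofReal (2 * (D * Real.exp (-(n * l - κ))))) hlim
    (fun n a => Metric.closedBall (Y n a.1 a.2 0) (rad n a)) (.of_forall fun n a => ?_)
    (.of_forall fun n x hx => ?_)
  · refine key.trans_lt (lt_of_le_of_lt (liminf_le_of_frequently_le'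
      (x := ENNReal.ofReal (hTf.toFinset.card * ((2 * D) ^ t * B)))
        (Frequently.of_forall fun n => ?_)) ENNReal.ofReal_lt_top)
    calc _ ≤ ∑ a : Σ w : hTf.toFinset, ι n w, ENNReal.ofReal ((2 * rad n a) ^ t) := by
          refine Finset.sum_le_sum fun a _ => ?_
          rw [← ENNReal.ofReal_rpow_of_nonneg (by have := hrad0 n a; positivity) ht]
          exact ENNReal.rpow_le_rpow (hdiam n a) ht
      _ = ENNReal.ofReal (∑ a : Σ w : hTf.toFinset, ι n w, (2 * rad n a) ^ t) :=
          (ENNReal.ofReal_sum_of_nonneg fun a _ => by have := hrad0 n a; positivity).symm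
      _ ≤ _ := by
          refine ENNReal.ofReal_le_ofReal ?_
          rw [Fintype.sum_sigma]
          have h1 : ∀ w : hTf.toFinset, ∑ a : ι n w, (2 * rad n ⟨w, a⟩) ^ t ≤
              (2 * D) ^ t * B := by
            intro w
            refine le_trans (le_of_eq ?_) (mul_le_mul_of_nonneg_left
              (hB n w (hT (hTf.mem_toFinset.1 w.2))) (by positivity))
            rw [hsum, Finset.mul_sum]
            refine Finset.sum_congr rfl fun a _ => ?_
            simp only [rad]
            rw [← mul_assoc, Real.mul_rpow (by positivity) (Real.exp_pos _).le, ← Real.exp_mul]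
            congr 2
            ring
          refine (Finset.sum_le_sum fun w _ => h1 w).trans ?_
          simp
  · refine (hdiam n a).trans (ENNReal.ofReal_le_ofReal ?_)
    have := hexp n _ (hY n a.1 a.2).1 (hYm n a)
    simp only [rad]
    gcongr
  · obtain ⟨z, hz, hz0⟩ := h.exists_orbit hx
    obtain ⟨w, hw, hzw⟩ := Set.mem_iUnion₂.1 (hcov (hz n).1)
    rw [Metric.mem_ball', dist_eq_norm] at hzw
    obtain ⟨y, hy, hyn, hym, -, hyk, hy0⟩ := hsh n z (fun i _ => (hz i).2) (fun i _ => (hz i).1)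
      w (hT hw) hzw.le
    obtain ⟨a, ha⟩ := hsurj n w y hy hyn
    refine Set.mem_iUnion.2 ⟨⟨⟨w, hTf.mem_toFinset.2 hw⟩, a⟩, ?_⟩
    rw [Metric.mem_closedBall', dist_eq_norm]
    simp only [rad]
    rw [ha 0 (Nat.zero_le _), ← hz0, logExpansionSum_congr fun i hi => ha i (le_of_lt hi)]
    refine hy0.trans ?_
    have h1 : -logExpansionSum p q z n ≤ k + -logExpansionSum p q y n := by
      linarith [(abs_le.1 hyk).2]
    calc _ ≤ K * Real.exp (k + -logExpansionSum p q y n) * r := by gcongr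
      _ = _ := by rw [hD, Real.exp_add]; ring

end IsHyperbolicRepeller

theorem pressure_eq_of_exponential_growth {X : Type*} [MetricSpace X] {f : X → X} {A : Set X}
    {φ : X → ℝ} {P : ℝ}
    (hup : ∀ ε > 0, ∃ C, ∀ n : ℕ, partitionSup f A φ n ε ≤ ENNReal.ofReal (Real.exp (n * P + C)))
    (hlow : ∃ ε > 0, ∃ C, ∀ n : ℕ,
      ENNReal.ofReal (Real.exp (n * P + C)) ≤ partitionSup f A φ n ε) :
    pressure f A φ = (P : EReal) := by
  have hlim : ∀ C : ℝ, Tendsto (fun n : ℕ => ENNReal.log (ENNReal.ofReal (Real.exp (n * P + C))) /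
      ((n : ℝ) : EReal)) atTop (𝓝 (P : EReal)) := by
    intro C
    have h1 : Tendsto (fun n : ℕ => P + C / n) atTop (𝓝 P) := by
      simpa using (tendsto_const_div_atTop_nhds_zero_nat C).const_add P
    refine ((continuous_coe_real_ereal.tendsto P).comp h1).congr' ?_
    filter_upwards [eventually_gt_atTop 0] with n hn
    rw [ENNReal.log_ofReal_of_pos (Real.exp_pos _), Real.log_exp, ← EReal.coe_div]
    simp only [Function.comp]
    congr 1
    field_simp
  have hmono : ∀ n : ℕ, Monotone fun x : EReal => x / ((n : ℝ) : EReal) := fun n =>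
    EReal.monotone_div_right_of_nonneg (by exact_mod_cast Nat.cast_nonneg (α := ℝ) n)
  refine le_antisymm (iSup₂_le fun ε hε => ?_) ?_
  · obtain ⟨C, hC⟩ := hup ε hε
    rw [← (hlim C).limsup_eq]
    exact limsup_le_limsup (.of_forall fun n => hmono n (ENNReal.log_le_log (hC n)))
  · obtain ⟨ε, hε, C, hC⟩ := hlow
    refine le_trans ?_ (le_iSup₂ (f := fun (ε : ℝ) (_ : 0 < ε) => limsup (fun n : ℕ =>
      ENNReal.log (partitionSup f A φ n ε) / ((n : ℝ) : EReal)) atTop) ε hε)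
    rw [← (hlim C).limsup_eq]
    exact limsup_le_limsup (.of_forall fun n => hmono n (ENNReal.log_le_log (hC n)))

theorem projectedOrbit_iterate (f : ℂ × ℂ → ℂ × ℂ) (x : ℂ × ℂ) (j i : ℕ) :
    projectedOrbit f (f^[j] x) i = projectedOrbit f x (i + j) := by
  rw [projectedOrbit, projectedOrbit, Function.iterate_add_apply]

namespace IsC2Extension

variable {p q : ℕ} {c : ℂ} {V : Set (ℂ × ℂ)} {f : ℂ × ℂ → ℂ × ℂ}

theorem mapsTo (h : IsC2Extension p q c V f) :
    Set.MapsTo f (closurePeriodicPts V f) (closurePeriodicPts V f) := fun x hx => by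
  have := Set.mem_image_of_mem f hx
  rwa [h.image_eq] at this

theorem continuousOn_projectedOrbit (h : IsC2Extension p q c V f) (i : ℕ) :
    ContinuousOn (fun x => projectedOrbit f x i) (closurePeriodicPts V f) :=
  continuous_fst.comp_continuousOn
    ((h.holomorphic.continuousOn.mono h.subset).iterate h.mapsTo i)

theorem exists_dist_le (h : IsC2Extension p q c V f) {ε : ℝ} (hε : 0 < ε) :
    ∃ N : ℕ, ∃ δ > (0 : ℝ), ∀ x ∈ closurePeriodicPts V f, ∀ y ∈ closurePeriodicPts V f,
      (∀ i ≤ N, ‖projectedOrbit f x i - projectedOrbit f y i‖ < δ) → dist x y ≤ ε := by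
  by_contra! hcon
  choose x hx y hy hclose hfar using fun n : ℕ =>
    hcon n (1 / ((n : ℝ) + 1)) Nat.one_div_pos_of_nat
  obtain ⟨⟨a, b⟩, ⟨ha, hb⟩, φ, hφ, hlim⟩ := (h.isCompact.prod h.isCompact).tendsto_subseq
    (x := fun n => (x n, y n)) fun n => ⟨hx n, hy n⟩
  have hxa : Tendsto (fun n => x (φ n)) atTop (𝓝 a) := (continuous_fst.tendsto _).comp hlim
  have hyb : Tendsto (fun n => y (φ n)) atTop (𝓝 b) := (continuous_snd.tendsto _).comp hlim
  have hab : a = b := by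
    refine h.bijOn.injOn ha hb (funext fun i => ?_)
    have hxi := (h.continuousOn_projectedOrbit i a ha).tendsto.comp
      (tendsto_nhdsWithin_iff.2 ⟨hxa, .of_forall fun n => hx (φ n)⟩)
    have hyi := (h.continuousOn_projectedOrbit i b hb).tendsto.comp
      (tendsto_nhdsWithin_iff.2 ⟨hyb, .of_forall fun n => hy (φ n)⟩)
    refine eq_of_sub_eq_zero (tendsto_nhds_unique (hxi.sub hyi) ?_)
    rw [tendsto_zero_iff_norm_tendsto_zero]
    refine squeeze_zero' (.of_forall fun _ => norm_nonneg _) ?_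
      (tendsto_one_div_add_atTop_nhds_zero_nat.comp hφ.tendsto_atTop)
    filter_upwards [hφ.tendsto_atTop.eventually_ge_atTop i] with n hn
    exact (hclose (φ n) i hn).le
  have := ge_of_tendsto' (hxa.dist hyb) fun n => (hfar (φ n)).le
  rw [hab, dist_self] at this
  linarith

theorem geometricPotential_eq (h : IsC2Extension p q c V f)
    (hrep : IsHyperbolicRepeller p q c (juliaSet p q c)) (hp : p ≠ 0) (hq : q ≠ 0) {x : ℂ × ℂ}
    (hx : x ∈ closurePeriodicPts V f) :
    geometricPotential p q c f x = -logExpansion p q (projectedOrbit f x 0) := by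
  have ho := h.bijOn.mapsTo hx 0
  have h0 := hrep.ne_zero ho.1
  rw [geometricPotential, (hasDerivAt_localBranch p q c _ h0).deriv, ho.2.norm_deriv hp hq h0,
    Real.log_exp]

theorem birkhoffSum_eq (h : IsC2Extension p q c V f)
    (hrep : IsHyperbolicRepeller p q c (juliaSet p q c)) (hp : p ≠ 0) (hq : q ≠ 0) {x : ℂ × ℂ}
    (hx : x ∈ closurePeriodicPts V f) (s : ℝ) (n : ℕ) :
    birkhoffSum f (fun x => s * geometricPotential p q c f x) n x =
      -s * logExpansionSum p q (projectedOrbit f x) n := by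
  rw [birkhoffSum, logExpansionSum, Finset.mul_sum]
  refine Finset.sum_congr rfl fun i _ => ?_
  rw [h.geometricPotential_eq hrep hp hq (h.mapsTo.iterate i hx), projectedOrbit_iterate, zero_add]
  ring

theorem exists_partitionSup_le (h : IsC2Extension p q c V f)
    (hrep : IsHyperbolicRepeller p q c (juliaSet p q c)) (hq : q ≠ 0) (hpq : q ≤ p) {s P k₀ : ℝ}
    (hP : ∀ n : ℕ, ∀ w ∈ juliaSet p q c, transferSum p q c s n w ≤ Real.exp (n * P + k₀))
    {ε : ℝ} (hε : 0 < ε) : ∃ C, ∀ n : ℕ, partitionSup f (closurePeriodicPts V f)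
      (fun x => s * geometricPotential p q c f x) n ε ≤
        ENNReal.ofReal (Real.exp (n * P + C)) := by
  have hp : p ≠ 0 := by omega
  obtain ⟨r, hr, K, hK, θ, hθ, k, hk, hθ1, hsh⟩ := hrep.exists_shadowing_mem hq hpq
  obtain ⟨M, hM, hbound⟩ := hrep.exists_abs_logExpansion_le
  obtain ⟨N, δ, hδ, hN⟩ := h.exists_dist_le hε
  obtain ⟨T, hT, hTf, hcov⟩ := hrep.isCompact.finite_cover_balls
    (lt_min hr (by positivity : 0 < δ / (4 * K)))
  refine ⟨hTf.toFinset.card + |s| * (k + N * M) + (N * P + k₀), fun n => ?_⟩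
  refine iSup₂_le fun E hE => ?_
  rw [← ENNReal.ofReal_sum_of_nonneg fun _ _ => (Real.exp_pos _).le]
  refine ENNReal.ofReal_le_ofReal ?_
  have horb : ∀ x ∈ E, projectedOrbit f x ∈ orbitSpace p q c (juliaSet p q c) :=
    fun x hx => h.bijOn.mapsTo (hE.1 hx)
  have hex : ∀ x ∈ E, ∃ w ∈ T, ∃ y, IsFiniteOrbit p q c (n + N) y ∧ y (n + N) = w ∧
      (∀ i ≤ n + N, ‖y i - projectedOrbit f x i‖ ≤ δ / 4) ∧
      |logExpansionSum p q y (n + N) - logExpansionSum p q (projectedOrbit f x) (n + N)| ≤ k := by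
    intro x hx
    obtain ⟨w, hw, hxw⟩ := Set.mem_iUnion₂.1 (hcov (horb x hx (n + N)).1)
    rw [Metric.mem_ball', dist_eq_norm] at hxw
    obtain ⟨y, hy, hyn, -, hye, hyk, -⟩ := hsh (n + N) _ (fun i _ => (horb x hx i).2)
      (fun i _ => (horb x hx i).1) w (hT hw) (hxw.le.trans (min_le_left _ _))
    refine ⟨w, hw, y, hy, hyn, fun i hi => (hye i hi).trans ?_, hyk⟩
    calc _ ≤ K * 1 * (δ / (4 * K)) := by
          gcongr
          · exact pow_le_one₀ hθ.le hθ1.le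
          · exact hxw.le.trans (min_le_right _ _)
      _ = _ := by field_simp
  choose! w hw y hy hyn hye hyk using hex
  have hinj : ∀ x ∈ E, ∀ x' ∈ E, (∀ i ≤ n + N, y x i = y x' i) → x = x' := by
    intro x hx x' hx' hxx
    by_contra hne
    obtain ⟨j, hj, hjε⟩ := hE.2 x hx x' hx' hne
    refine absurd (hN _ (h.mapsTo.iterate j (hE.1 hx)) _ (h.mapsTo.iterate j (hE.1 hx'))
      fun i hi => ?_) (not_le.2 hjε)
    rw [projectedOrbit_iterate, projectedOrbit_iterate]
    have h1 := hye x hx (i + j) (by omega)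
    have h2 := hye x' hx' (i + j) (by omega)
    rw [← hxx (i + j) (by omega)] at h2
    rw [norm_sub_rev] at h1
    have := norm_sub_le_norm_sub_add_norm_sub (projectedOrbit f x (i + j)) (y x (i + j))
      (projectedOrbit f x' (i + j))
    linarith
  classical
  calc _ ≤ ∑ x ∈ E, Real.exp (|s| * (k + N * M)) *
        Real.exp (-s * logExpansionSum p q (y x) (n + N)) := by
        refine Finset.sum_le_sum fun x hx => ?_
        rw [h.birkhoffSum_eq hrep hp hq (hE.1 hx), ← Real.exp_add, Real.exp_le_exp]
        have h1 := hyk x hx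
        rw [logExpansionSum_add _ _ (projectedOrbit f x)] at h1
        have h2 := abs_logExpansionSum_le hbound (n := N)
          (z := fun i => projectedOrbit f x (n + i)) fun i _ => (horb x hx (n + i)).1
        have h3 : |logExpansionSum p q (y x) (n + N) -
            logExpansionSum p q (projectedOrbit f x) n| ≤ k + N * M := by
          rw [abs_le] at *
          constructor <;> linarith
        have h4 := mul_le_mul_of_nonneg_left h3 (abs_nonneg s)
        rw [← abs_mul] at h4
        linarith [le_abs_self (s * (logExpansionSum p q (y x) (n + N) -
          logExpansionSum p q (projectedOrbit f x) n))]
    _ = Real.exp (|s| * (k + N * M)) * ∑ v ∈ hTf.toFinset, ∑ x ∈ E with w x = v,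
        Real.exp (-s * logExpansionSum p q (y x) (n + N)) := by
        rw [← Finset.mul_sum, Finset.sum_fiberwise_of_maps_to fun x hx =>
          hTf.mem_toFinset.2 (hw x hx)]
    _ ≤ Real.exp (|s| * (k + N * M)) * ∑ v ∈ hTf.toFinset,
        Real.exp ((n + N : ℕ) * P + k₀) := by
        gcongr with v hv
        refine le_trans (sum_exp_le_transferSum (q := q) (c := c) hp s (n + N) v _ y ?_ ?_)
          (hP (n + N) v (hT (hTf.mem_toFinset.1 hv)))
        · intro x hx
          obtain ⟨hxE, hxv⟩ := Finset.mem_filter.1 hx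
          exact ⟨hy x hxE, (hyn x hxE).trans hxv⟩
        · intro x hx x' hx'
          exact hinj x (Finset.mem_filter.1 hx).1 x' (Finset.mem_filter.1 hx').1
    _ ≤ Real.exp (|s| * (k + N * M)) * (Real.exp hTf.toFinset.card *
        Real.exp ((n + N : ℕ) * P + k₀)) := by
        rw [Finset.sum_const, nsmul_eq_mul]
        gcongr
        linarith [Real.add_one_le_exp (hTf.toFinset.card : ℝ)]
    _ = _ := by
        rw [← Real.exp_add, ← Real.exp_add]
        push_cast
        congr 1
        ring

theorem exists_le_partitionSup (h : IsC2Extension p q c V f)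
    (hrep : IsHyperbolicRepeller p q c (juliaSet p q c)) (hne : (juliaSet p q c).Nonempty)
    (hq : q ≠ 0) (hpq : q ≤ p) : ∃ ε > 0, ∃ w ∈ juliaSet p q c, ∀ (s : ℝ) (n : ℕ),
      ENNReal.ofReal (transferSum p q c s n w) ≤ partitionSup f (closurePeriodicPts V f)
        (fun x => s * geometricPotential p q c f x) n ε := by
  have hp : p ≠ 0 := by omega
  obtain ⟨δ, hδ, huniq⟩ := hrep.exists_eq_of_close hp hq
  obtain ⟨w, hw⟩ := hne
  refine ⟨δ / 2, half_pos hδ, w, hw, fun s n => ?_⟩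
  obtain ⟨τ, hτ, hτ0⟩ := hrep.exists_orbit hw
  obtain ⟨ι, _, Y, hY, hinj, -, hsum⟩ := exists_backwardOrbit_enumeration (q := q) (c := c) hp n w
  have hYm : ∀ a, ∀ i ≤ n, Y a i ∈ juliaSet p q c := fun a =>
    hrep.mem_of_isFiniteOrbit (hY a).1 ((hY a).2 ▸ hw)
  have hglue : ∀ a, glue n (Y a) τ ∈ orbitSpace p q c (juliaSet p q c) := by
    intro a i
    have h0 : Y a n = τ 0 := by rw [(hY a).2, hτ0]
    refine ⟨?_, isFiniteOrbit_glue (hY a).1 (m := i + 1) (fun j _ => (hτ j).2) h0 i (by omega)⟩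
    rcases le_total i n with h1 | h1
    · rw [glue_of_le h1]
      exact hYm a i h1
    · obtain ⟨j, rfl⟩ := Nat.exists_eq_add_of_le h1
      rw [glue_add h0]
      exact (hτ j).1
  choose x hx hxo using fun a => h.bijOn.surjOn (hglue a)
  have hxi : ∀ a, ∀ i ≤ n, projectedOrbit f (x a) i = Y a i := fun a i hi => by
    rw [hxo, glue_of_le hi]
  have hxinj : Function.Injective x := fun a b hab => hinj a b fun i hi => by
    rw [← hxi a i hi, ← hxi b i hi, hab]
  rw [hsum, ENNReal.ofReal_sum_of_nonneg fun _ _ => (Real.exp_pos _).le]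
  refine le_trans (le_of_eq ?_) (le_iSup₂ (f := fun (E : Finset (ℂ × ℂ))
    (_ : IsSeparatedIn f (closurePeriodicPts V f) n (δ / 2) E) => ∑ x ∈ E, ENNReal.ofReal
      (Real.exp (birkhoffSum f (fun x => s * geometricPotential p q c f x) n x)))
      (Finset.univ.map ⟨x, hxinj⟩) ⟨?_, ?_⟩)
  · rw [Finset.sum_map]
    refine Finset.sum_congr rfl fun a _ => ?_
    rw [Function.Embedding.coeFn_mk, h.birkhoffSum_eq hrep hp hq (hx a),
      logExpansionSum_congr fun i hi => hxi a i (le_of_lt hi)]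
  · intro y hy
    simp only [Finset.coe_map, Function.Embedding.coeFn_mk, Finset.coe_univ, Set.image_univ,
      Set.mem_range] at hy
    obtain ⟨a, rfl⟩ := hy
    exact hx a
  · intro y hy y' hy' hyy
    simp only [Finset.mem_map, Finset.mem_univ, true_and, Function.Embedding.coeFn_mk] at hy hy'
    obtain ⟨a, rfl⟩ := hy
    obtain ⟨b, rfl⟩ := hy'
    by_contra! hcon
    refine hyy (congrArg x (hinj a b (huniq n _ _ (hY a).1 (hY b).1 (hYm b)
      (by rw [(hY a).2, (hY b).2]) fun i hi => ?_)))
    have h1 : dist (f^[i] (x a)).1 (f^[i] (x b)).1 ≤ δ / 2 :=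
      (le_max_left _ _).trans (hcon i hi)
    rw [← hxi a i hi.le, ← hxi b i hi.le, ← dist_eq_norm]
    exact h1.trans_lt (by linarith)

theorem pressure_eq (h : IsC2Extension p q c V f)
    (hrep : IsHyperbolicRepeller p q c (juliaSet p q c)) (hne : (juliaSet p q c).Nonempty)
    (hq : q ≠ 0) (hpq : q ≤ p) {s P k : ℝ} (hP : ∀ n : ℕ, ∀ w ∈ juliaSet p q c,
      Real.exp (n * P - k) ≤ transferSum p q c s n w ∧
        transferSum p q c s n w ≤ Real.exp (n * P + k)) :
    pressure f (closurePeriodicPts V f) (fun x => s * geometricPotential p q c f x) =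
      (P : EReal) := by
  refine pressure_eq_of_exponential_growth
    (fun ε hε => h.exists_partitionSup_le hrep hq hpq (fun n w hw => (hP n w hw).2) hε) ?_
  obtain ⟨ε, hε, w, hw, hle⟩ := h.exists_le_partitionSup hrep hne hq hpq
  exact ⟨ε, hε, -k, fun n => (ENNReal.ofReal_le_ofReal (hP n w hw).1).trans (hle s n)⟩

end IsC2Extension

/-- Pulling back an orbit with a crude bound on the error. -/
theorem exists_pullback_crude {p q : ℕ} {c : ℂ} (hq : q ≠ 0) (hpq : q ≤ p) {a : ℝ} (ha : 0 < a) :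
    ∃ G ≥ (1 : ℝ), ∀ (n : ℕ) (z : ℕ → ℂ), IsFiniteOrbit p q c n z →
      (∀ i ≤ n, a ≤ ‖z i‖ ∧ a ≤ ‖z i - c‖) → ∀ w, G ^ n * ‖w - z n‖ ≤ a / 2 →
      ∃ y, IsFiniteOrbit p q c n y ∧ y n = w ∧ ∀ i ≤ n, ‖y i - z i‖ ≤ G ^ n * ‖w - z n‖ := by
  have hα : 0 ≤ (p : ℝ) / q - 1 := by
    rw [sub_nonneg, one_le_div (by positivity)]
    exact_mod_cast hpq
  set L := Real.log ((p : ℝ) / q) + ((p : ℝ) / q - 1) * Real.log a with hL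
  have hlow : ∀ z : ℂ, a ≤ ‖z‖ → L ≤ logExpansion p q z := fun z hz => by
    rw [hL, logExpansion]
    have := Real.log_le_log ha hz
    gcongr
  refine ⟨max 1 (Real.exp (-L) * 2), le_max_left _ _, fun n => ?_⟩
  set G := max 1 (Real.exp (-L) * 2) with hG
  have hG1 : 1 ≤ G := le_max_left _ _
  induction n with
  | zero =>
    intro z hz _ w _
    refine ⟨fun _ => w, fun i hi => absurd hi (by omega), rfl, fun i hi => ?_⟩
    rw [Nat.le_zero.1 hi]
    simp
  | succ n ih =>
    intro z hz hm w hw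
    have hstep : G ^ n * ‖w - z (n + 1)‖ ≤ G ^ (n + 1) * ‖w - z (n + 1)‖ := by
      gcongr
      omega
    obtain ⟨x, hx, hxn, hxe⟩ := ih (fun i => z (i + 1)) (fun i hi => hz (i + 1) (by omega))
      (fun i hi => hm (i + 1) (by omega)) w (hstep.trans hw)
    have he := hxe 0 (Nat.zero_le _)
    have hz1 := (hm 1 (by omega)).2
    have hz1' : 0 < ‖z 1 - c‖ := ha.trans_le hz1
    rw [zero_add] at he
    have he2 : ‖x 0 - z 1‖ ≤ ‖z 1 - c‖ / 2 := by linarith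
    obtain ⟨x₀, hx₀, hx₀e⟩ := (hz 0 (by omega)).exists_isImage_near hq hpq
      (norm_pos_iff.1 (ha.trans_le (hm 0 (by omega)).1)) (w := x 0) (by rwa [zero_add])
    rw [zero_add] at hx₀e
    refine ⟨fun i => Nat.casesOn i x₀ x, ?_, hxn, ?_⟩
    · intro i hi
      cases i with
      | zero => exact hx₀
      | succ i => exact hx i (by omega)
    · intro i hi
      cases i with
      | succ i => exact (hxe i (by omega)).trans hstep
      | zero =>
        refine hx₀e.trans ?_
        have h1 : Real.exp (-logExpansion p q (z 0)) * (1 + 2 / ‖z 1 - c‖ * ‖x 0 - z 1‖) ≤ G := by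
          refine le_trans ?_ (le_max_right _ _)
          have h2 : 2 / ‖z 1 - c‖ * ‖x 0 - z 1‖ ≤ 1 := by
            rw [div_mul_eq_mul_div, div_le_one hz1']
            linarith
          have h3 := hlow _ (hm 0 (by omega)).1
          gcongr
          linarith
        calc _ ≤ G * (G ^ n * ‖w - z (n + 1)‖) := by gcongr
          _ = _ := by ring

namespace IsHyperbolicRepeller

variable {p q : ℕ} {c : ℂ} {Λ : Set ℂ}

/-- The repeller contains every orbit that stays close to it. -/
theorem exists_isolating (h : IsHyperbolicRepeller p q c Λ) (hq : q ≠ 0) (hpq : q ≤ p) :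
    ∃ η > (0 : ℝ), ∀ z : ℕ → ℂ,
      (∀ i, z i ∈ Metric.thickening η Λ ∧ IsImage p q c (z i) (z (i + 1))) → ∀ i, z i ∈ Λ := by
  have hp : p ≠ 0 := by omega
  obtain ⟨r, hr, K, hK, θ, hθ, hθ1, hsh⟩ := h.exists_shadowing hq hpq
  obtain ⟨a, ha, hlow⟩ := h.exists_norm_lower_bound hp hq
  obtain ⟨κ, hκ, huniq⟩ := Corr.exists_eq_of_close hp
  obtain ⟨G, hG, hpull⟩ := exists_pullback_crude (c := c) hq hpq (half_pos ha)
  obtain ⟨N, hN⟩ := exists_pow_lt_of_lt_one (by positivity : 0 < 1 / (2 * K)) hθ1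
  have hG0 : 0 < G := by linarith
  have hKN : K * θ ^ N ≤ 1 / 2 := by
    calc _ ≤ K * (1 / (2 * K)) := by gcongr
      _ = _ := by field_simp
  set η := min (min r (a / 2)) (min (a / 2 / 2 / G ^ N) (κ * (a / 2) / (2 * (K + G ^ N)))) with hη
  have hη0 : 0 < η := by positivity
  have hη1 : η ≤ r := (min_le_left _ _).trans (min_le_left _ _)
  have hη2 : η ≤ a / 2 := (min_le_left _ _).trans (min_le_right _ _)
  have hη3 : G ^ N * η ≤ a / 2 / 2 := by
    rw [mul_comm, ← le_div_iff₀ (by positivity)]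
    exact (min_le_right _ _).trans (min_le_left _ _)
  have hη4 : (K + G ^ N) * η < κ * (a / 2) := by
    have : η ≤ κ * (a / 2) / (2 * (K + G ^ N)) := (min_le_right _ _).trans (min_le_right _ _)
    rw [le_div_iff₀ (by positivity)] at this
    have h2 : 0 < (K + G ^ N) * η := by positivity
    linarith
  refine ⟨η, hη0, fun z hz => ?_⟩
  have hnear : ∀ i, ∃ y ∈ Λ, ‖y - z i‖ ≤ η := fun i => by
    obtain ⟨y, hy, hd⟩ := Metric.mem_thickening_iff.1 (hz i).1
    rw [dist_comm, dist_eq_norm] at hd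
    exact ⟨y, hy, hd.le⟩
  have hzlow : ∀ i, a / 2 ≤ ‖z i‖ ∧ a / 2 ≤ ‖z i - c‖ := fun i => by
    obtain ⟨y, hy, hd⟩ := hnear i
    have h1 := norm_sub_norm_le y (z i)
    have h2 := norm_sub_norm_le (y - c) (z i - c)
    rw [sub_sub_sub_cancel_right] at h2
    have h3 := hlow y hy
    constructor <;> linarith
  have hhalf : ∀ e ≤ η, (∀ i, ∃ y ∈ Λ, ‖y - z i‖ ≤ e) → ∀ i, ∃ y ∈ Λ, ‖y - z i‖ ≤ e / 2 := by
    intro e he hclose i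
    obtain ⟨w, hw, hwe⟩ := hclose (i + N)
    have hwη := hwe.trans he
    have hzo : IsFiniteOrbit p q c N fun j => z (i + j) := fun j _ => (hz (i + j)).2
    have hGw : G ^ N * ‖w - z (i + N)‖ ≤ G ^ N * η := by gcongr
    obtain ⟨y, hy, hyN, hye⟩ := hpull N (fun j => z (i + j)) hzo (fun j _ => hzlow (i + j)) w
      (hGw.trans hη3)
    have hym := h.mem_of_isFiniteOrbit hy (hyN ▸ hw)
    have hzw : ‖z (i + N) - y N‖ = ‖w - z (i + N)‖ := by rw [hyN, norm_sub_rev]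
    obtain ⟨x, hx, hxN, hxe, -⟩ := hsh N y hy hym (z (i + N)) (by rw [hzw]; linarith)
    have hxz : x 0 = z (i + 0) := by
      refine huniq q c N x (fun j => z (i + j)) hx hzo hxN (fun j hj => ?_) 0 (Nat.zero_le _)
      have h1 := hxe j hj.le
      have h2 := hye j hj.le
      rw [hzw] at h1
      have h3 : K * θ ^ (N - j) * ‖w - z (i + N)‖ ≤ K * 1 * η := by
        gcongr
        exact pow_le_one₀ hθ.le hθ1.le
      have h4 := norm_sub_le_norm_sub_add_norm_sub (x j) (y j) (z (i + j))
      have h5 : κ * (a / 2) ≤ κ * ‖z (i + j)‖ := by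
        gcongr
        exact (hzlow (i + j)).1
      linarith
    refine ⟨y 0, hym 0 (Nat.zero_le _), ?_⟩
    have h1 := hxe 0 (Nat.zero_le _)
    rw [hxz, add_zero, hzw, Nat.sub_zero] at h1
    rw [norm_sub_rev]
    calc _ ≤ _ := h1
      _ ≤ 1 / 2 * e := by gcongr
      _ = _ := by ring
  have hall : ∀ n : ℕ, ∀ i, ∃ y ∈ Λ, ‖y - z i‖ ≤ η / 2 ^ n := by
    intro n
    induction n with
    | zero => simpa using hnear
    | succ n ih =>
      rw [pow_succ, ← div_div]
      exact hhalf _ (div_le_self hη0.le (one_le_pow₀ one_le_two)) ih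
  intro i
  rw [← h.isCompact.isClosed.closure_eq, Metric.mem_closure_iff]
  intro ε hε
  obtain ⟨n, hn⟩ := exists_pow_lt_of_lt_one (by positivity : 0 < ε / η)
    (by norm_num : (1 / 2 : ℝ) < 1)
  obtain ⟨y, hy, hd⟩ := hall n i
  refine ⟨y, hy, ?_⟩
  rw [dist_comm, dist_eq_norm]
  refine hd.trans_lt ?_
  rw [lt_div_iff₀ hη0] at hn
  rw [one_div, inv_pow, inv_mul_eq_div] at hn
  exact hn

/-- Periodic orbits are dense in the space of orbits. -/
theorem exists_periodic_near (h : IsHyperbolicRepeller p q c Λ) (hLEO : IsLEO p q c Λ)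
    (hq : q ≠ 0) (hpq : q ≤ p) {z : ℕ → ℂ} (hz : z ∈ orbitSpace p q c Λ) (N : ℕ) {ε : ℝ}
    (hε : 0 < ε) : ∃ y ∈ orbitSpace p q c Λ, (∃ m > 0, ∀ i, y (i + m) = y i) ∧
      ∀ i ≤ N, ‖y i - z i‖ < ε := by
  have hp : p ≠ 0 := by omega
  obtain ⟨r, hr, K, hK, θ, hθ, k, hk, hθ1, hsh⟩ := h.exists_shadowing_mem hq hpq
  obtain ⟨δ, hδ, huniq⟩ := h.exists_eq_of_close hp hq
  set ρ := min (r / (K + 2)) (δ / (8 * (K + 1) ^ 2)) with hρ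
  have hρ0 : 0 < ρ := by positivity
  have hρ1 : ρ * (K + 2) ≤ r := (le_div_iff₀ (by positivity)).1 (min_le_left _ _)
  have hρ2 : ρ * (8 * (K + 1) ^ 2) ≤ δ := (le_div_iff₀ (by positivity)).1 (min_le_right _ _)
  have hρr : ρ ≤ r := by nlinarith
  obtain ⟨n₀, hn₀⟩ := exists_pow_lt_of_lt_one (by positivity :
    0 < min (ε / (K * ((K + 1) * ρ))) (1 / (2 * K * (K + 1)))) hθ1
  have hn₁ : K * θ ^ n₀ * ((K + 1) * ρ) < ε := by
    have := hn₀.trans_le (min_le_left _ _)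
    rw [lt_div_iff₀ (by positivity)] at this
    linarith
  have hn₂ : K * θ ^ n₀ * (K + 1) ≤ 1 / 2 := by
    have := hn₀.le.trans (min_le_right _ _)
    rw [le_div_iff₀ (by positivity)] at this
    linarith
  set n := N + (n₀ + 1) with hn
  have hθn : ∀ i ≤ N, θ ^ (n - i) ≤ θ ^ n₀ := fun i hi =>
    pow_le_pow_of_le_one hθ.le hθ1.le (by omega)
  have hθle : ∀ i, θ ^ i ≤ 1 := fun i => pow_le_one₀ hθ.le hθ1.le
  obtain ⟨_, hu⟩ := hLEO.exists_uniform h.isCompact hρ0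
  obtain ⟨m, -, u, hu, hu0, huz, hum⟩ := hu (z n) (hz n).1 (z 0) (hz 0).1
  have humem := h.mem_of_isFiniteOrbit hu (hum ▸ (hz 0).1)
  let D : Set ℂ := Metric.closedBall (z 0) ρ ∩ Λ
  have hDw : ∀ w ∈ D, w ∈ Λ ∧ ‖w - z 0‖ ≤ ρ := fun w hw =>
    ⟨hw.2, by rw [← dist_eq_norm]; exact hw.1⟩
  have hX : ∀ w ∈ D, ∃ X : ℕ → ℂ, IsFiniteOrbit p q c (n + m) X ∧ X (n + m) = w ∧
      (∀ i ≤ n, ‖X i - z i‖ ≤ K * θ ^ (n - i) * ((K + 1) * ρ)) ∧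
      (∀ i ≤ m, ‖X (n + i) - u i‖ ≤ K * ρ) := by
    intro w hw
    obtain ⟨hwΛ, hwz⟩ := hDw w hw
    obtain ⟨x, hx, hxm, hxmem, hxe, -⟩ := hsh m u hu humem w hwΛ (by rw [hum]; linarith)
    have hxe' : ∀ i ≤ m, ‖x i - u i‖ ≤ K * ρ := fun i hi => by
      refine (hxe i hi).trans ?_
      rw [hum]
      calc _ ≤ K * 1 * ρ := by gcongr; exact hθle _
        _ = _ := by ring
    have hx0 : ‖x 0 - z n‖ ≤ (K + 1) * ρ := by
      have := norm_sub_le_norm_sub_add_norm_sub (x 0) (u 0) (z n)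
      linarith [hxe' 0 (Nat.zero_le _)]
    obtain ⟨y, hy, hyn, -, hye, -⟩ := hsh n z (fun i _ => (hz i).2) (fun i _ => (hz i).1) (x 0)
      (hxmem 0 (Nat.zero_le _)) (by linarith)
    refine ⟨glue n y x, isFiniteOrbit_glue hy hx hyn, by rw [glue_add hyn, hxm], fun i hi => ?_,
      fun i hi => by rw [glue_add hyn]; exact hxe' i hi⟩
    rw [glue_of_le hi]
    refine (hye i hi).trans ?_
    gcongr
  choose! X hXo hXw hXz hXu using hX
  have hXmem : ∀ w ∈ D, ∀ i ≤ n + m, X w i ∈ Λ := fun w hw =>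
    h.mem_of_isFiniteOrbit (hXo w hw) (by rw [hXw w hw]; exact hw.2)
  have hmaps : Set.MapsTo (fun w => X w 0) D D := by
    intro w hw
    refine ⟨?_, hXmem w hw 0 (Nat.zero_le _)⟩
    rw [Metric.mem_closedBall, dist_eq_norm]
    refine (hXz w hw 0 (Nat.zero_le _)).trans ?_
    calc _ ≤ K * θ ^ n₀ * ((K + 1) * ρ) :=
          mul_le_mul_of_nonneg_right (mul_le_mul_of_nonneg_left (hθn 0 (Nat.zero_le _)) hK.le)
            (by positivity)
      _ = K * θ ^ n₀ * (K + 1) * ρ := by ring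
      _ ≤ 1 / 2 * ρ := by gcongr
      _ ≤ ρ := by linarith
  have hdistXX : ∀ w ∈ D, ∀ w' ∈ D, ∀ i ≤ n + m,
      ‖X w i - X w' i‖ ≤ 2 * (K * (K + 1) * ρ + K * ρ) := by
    intro w hw w' hw' i hi
    have hKρ : 0 ≤ K * ρ := by positivity
    have hKKρ : 0 ≤ K * (K + 1) * ρ := by positivity
    rcases le_total i n with h1 | h1
    · have hb : K * θ ^ (n - i) * ((K + 1) * ρ) ≤ K * 1 * ((K + 1) * ρ) := by
        gcongr
        exact hθle _
      have h2 := hXz w hw i h1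
      have h3 := hXz w' hw' i h1
      rw [norm_sub_rev] at h3
      linarith [norm_sub_le_norm_sub_add_norm_sub (X w i) (z i) (X w' i)]
    · obtain ⟨j, rfl⟩ := Nat.exists_eq_add_of_le h1
      have h2 := hXu w hw j (by omega)
      have h3 := hXu w' hw' j (by omega)
      rw [norm_sub_rev] at h3
      linarith [norm_sub_le_norm_sub_add_norm_sub (X w (n + j)) (u j) (X w' (n + j))]
  have hcontr : ∀ w ∈ D, ∀ w' ∈ D, ‖X w 0 - X w' 0‖ ≤ 1 / 2 * ‖w - w'‖ := by
    intro w hw w' hw'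
    have hww : ‖w - w'‖ ≤ 2 * ρ := by
      have h1 := (hDw w hw).2
      have h2 := (hDw w' hw').2
      rw [norm_sub_rev] at h2
      linarith [norm_sub_le_norm_sub_add_norm_sub w (z 0) w']
    obtain ⟨x, hx, hxn, -, hxe, -⟩ := hsh (n + m) (X w') (hXo w' hw') (hXmem w' hw') w hw.2
      (by rw [hXw w' hw']; nlinarith)
    rw [hXw w' hw'] at hxe
    have hxX : x 0 = X w 0 := by
      refine huniq (n + m) x (X w) hx (hXo w hw) (hXmem w hw) (by rw [hxn, hXw w hw])
        (fun i hi => ?_) 0 (Nat.zero_le _)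
      have h1 := hxe i hi.le
      have h2 : K * θ ^ (n + m - i) * ‖w - w'‖ ≤ K * 1 * (2 * ρ) := by
        gcongr
        exact hθle _
      have h3 := hdistXX w' hw' w hw i hi.le
      have h4 := norm_sub_le_norm_sub_add_norm_sub (x i) (X w' i) (X w i)
      nlinarith [mul_pos hK hρ0, mul_pos hK (mul_pos hK hρ0)]
    rw [← hxX]
    refine (hxe 0 (Nat.zero_le _)).trans ?_
    gcongr
    calc K * θ ^ (n + m - 0) ≤ K * θ ^ n₀ * 1 := by
          rw [mul_one]
          gcongr 1
          exact pow_le_pow_of_le_one hθ.le hθ1.le (by omega)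
      _ ≤ K * θ ^ n₀ * (K + 1) := by gcongr; linarith
      _ ≤ _ := hn₂
  have hcw : ContractingWith (1 / 2) (hmaps.restrict (fun w => X w 0) D D) := by
    refine ⟨by norm_num, LipschitzWith.of_dist_le_mul fun w w' => ?_⟩
    rw [Subtype.dist_eq, Subtype.dist_eq, dist_eq_norm, dist_eq_norm]
    simpa using hcontr w w.2 w' w'.2
  have hDc : IsComplete D := (Metric.isClosed_closedBall.inter h.isCompact.isClosed).isComplete
  obtain ⟨w, hw, hfix, -⟩ := hcw.exists_fixedPoint' hDc hmaps
    (⟨Metric.mem_closedBall_self hρ0.le, (hz 0).1⟩ : z 0 ∈ D) (edist_ne_top _ _)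
  have hX0 : X w (n + m) = X w 0 := (hXw w hw).trans hfix.symm
  have hL : 0 < n + m := by omega
  refine ⟨fun i => X w (i % (n + m)), fun i => ⟨hXmem w hw _ (Nat.mod_lt _ hL).le, ?_⟩,
    ⟨n + m, hL, fun i => by simp⟩, fun i hi => ?_⟩
  · have h1 := hXo w hw (i % (n + m)) (Nat.mod_lt _ hL)
    have h2 : X w ((i + 1) % (n + m)) = X w (i % (n + m) + 1) := by
      rw [Nat.add_mod_eq_ite]
      have h3 := Nat.mod_lt i hL
      rcases Nat.lt_or_ge 1 (n + m) with h4 | h4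
      · rw [Nat.mod_eq_of_lt h4]
        split_ifs with h5
        · rw [show i % (n + m) + 1 = n + m by omega, hX0, Nat.sub_self]
        · rfl
      · have h5 : n + m = 1 := by omega
        simp only [h5, Nat.mod_one] at hX0 ⊢
        simpa using hX0.symm
    simp only
    rw [h2]
    exact h1
  · simp only
    rw [Nat.mod_eq_of_lt (by omega)]
    refine (hXz w hw i (by omega)).trans_lt (lt_of_le_of_lt ?_ hn₁)
    exact mul_le_mul_of_nonneg_right (mul_le_mul_of_nonneg_left (hθn i hi) hK.le) (by positivity)

end IsHyperbolicRepeller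

/-- The point of `ℂ²` that codes the sequence `z`: its second coordinate is a power series in a
small parameter `ε` whose coefficients are the points following `z 0`. -/
def orbitCode (ε : ℂ) (z : ℕ → ℂ) : ℂ × ℂ := (z 0, ∑' i, ε ^ i * z (i + 1))

section orbitCode

variable {ε : ℂ} {R : ℝ} {z : ℕ → ℂ}

theorem norm_pow_mul_le (hR : ∀ i, ‖z i‖ ≤ R) (i : ℕ) : ‖ε ^ i * z (i + 1)‖ ≤ ‖ε‖ ^ i * R := by
  rw [norm_mul, norm_pow]
  exact mul_le_mul_of_nonneg_left (hR _) (by positivity)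

theorem summable_norm_pow_mul (hε : ‖ε‖ < 1) : Summable fun i => ‖ε‖ ^ i * R :=
  (summable_geometric_of_lt_one (norm_nonneg _) hε).mul_right R

theorem orbitCode_snd_eq (hε : ‖ε‖ < 1) (hR : ∀ i, ‖z i‖ ≤ R) :
    (orbitCode ε z).2 = z 1 + ε * (orbitCode ε fun i => z (i + 1)).2 := by
  have hs : Summable fun i => ε ^ i * z (i + 1) :=
    Summable.of_norm_bounded (summable_norm_pow_mul hε) (norm_pow_mul_le hR)
  simp only [orbitCode]
  rw [hs.tsum_eq_zero_add, ← tsum_mul_left]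
  simp only [pow_zero, one_mul, zero_add, pow_succ']
  simp only [mul_assoc]

theorem norm_orbitCode_snd_le (hε : ‖ε‖ ≤ 1 / 2) (hR : ∀ i, ‖z i‖ ≤ R) :
    ‖(orbitCode ε z).2‖ ≤ 2 * R := by
  have hR0 : 0 ≤ R := (norm_nonneg _).trans (hR 0)
  have hε1 : ‖ε‖ < 1 := by linarith
  refine (tsum_of_norm_bounded (summable_norm_pow_mul hε1).hasSum (norm_pow_mul_le hR)).trans ?_
  rw [tsum_mul_right, tsum_geometric_of_lt_one (norm_nonneg _) hε1]
  gcongr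
  rw [inv_le_comm₀ (by linarith) (by norm_num)]
  linarith

theorem continuousOn_orbitCode {S : Set (ℕ → ℂ)} (hε : ‖ε‖ < 1)
    (hR : ∀ z ∈ S, ∀ i, ‖z i‖ ≤ R) : ContinuousOn (orbitCode ε) S := by
  refine (continuous_apply 0).continuousOn.prodMk ?_
  refine continuousOn_tsum (fun i => ?_) (summable_norm_pow_mul hε)
    fun i z hz => norm_pow_mul_le (hR z hz) i
  exact (continuous_const.mul (continuous_apply (i + 1))).continuousOn

end orbitCode

theorem isCompact_orbitSpace {p q : ℕ} {c : ℂ} {Λ : Set ℂ} (hΛ : IsCompact Λ) :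
    IsCompact (orbitSpace p q c Λ) := by
  have hsub : orbitSpace p q c Λ =
      Set.univ.pi (fun _ => Λ) ∩ ⋂ i, {z : ℕ → ℂ | IsImage p q c (z i) (z (i + 1))} := by
    ext z
    simp [orbitSpace, forall_and]
  rw [hsub]
  refine (isCompact_univ_pi fun _ => hΛ).inter_right (isClosed_iInter fun i => ?_)
  exact isClosed_eq (((continuous_apply (i + 1)).sub continuous_const).pow q)
    ((continuous_apply i).pow p)

namespace IsHyperbolicRepeller

variable {p q : ℕ} {c : ℂ} {Λ : Set ℂ}

/-- Near the repeller, distinct images of a point are uniformly apart. -/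
theorem exists_image_separation (h : IsHyperbolicRepeller p q c Λ) (hp : p ≠ 0) (hq : q ≠ 0) :
    ∃ η > (0 : ℝ), ∃ r > (0 : ℝ), ∀ z ∈ Metric.thickening η Λ, z ≠ 0 ∧ ∀ v v' w : ℂ,
      IsImage p q c z v → IsImage p q c z v' → ‖w - v‖ < r → ‖w - v'‖ < r → v = v' := by
  obtain ⟨a, ha, hlow⟩ := h.exists_norm_lower_bound hp hq
  obtain ⟨κ, hκ, hsep⟩ := exists_root_separation hq
  set b := min 1 ((a / 2) ^ p) with hb
  have hb0 : 0 < b := by positivity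
  refine ⟨a / 2, half_pos ha, κ * b / 2, by positivity, fun z hz => ?_⟩
  obtain ⟨y, hy, hd⟩ := Metric.mem_thickening_iff.1 hz
  rw [dist_comm, dist_eq_norm] at hd
  have hza : a / 2 ≤ ‖z‖ := by
    linarith [norm_sub_norm_le y z, (hlow y hy).1]
  refine ⟨norm_pos_iff.1 (by linarith), fun v v' w hv hv' hwv hwv' => ?_⟩
  have hbv : b ≤ ‖v' - c‖ := by
    have h1 := congrArg norm hv'
    rw [norm_pow, norm_pow] at h1
    refine le_of_pow_le_pow_left₀ hq (norm_nonneg _) ?_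
    rw [h1]
    calc b ^ q ≤ b := pow_le_of_le_one hb0.le (min_le_left _ _) hq
      _ ≤ (a / 2) ^ p := min_le_right _ _
      _ ≤ _ := by gcongr
  have h2 : v - c = v' - c := by
    refine hsep _ _ (hv.trans hv'.symm) ?_
    rw [sub_sub_sub_cancel_right]
    have h3 := norm_sub_le_norm_sub_add_norm_sub v w v'
    rw [norm_sub_rev v w] at h3
    have h4 : κ * b ≤ κ * ‖v' - c‖ := by gcongr
    linarith
  exact sub_left_injective h2

/-- A holomorphic map of an open subset of `ℂ²` whose maximal invariant set is a coded copy of the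
space of orbits in the repeller. -/
theorem exists_coded_shift (h : IsHyperbolicRepeller p q c Λ) (hq : q ≠ 0) (hpq : q ≤ p) :
    ∃ (ε : ℂ) (V : Set (ℂ × ℂ)) (f : ℂ × ℂ → ℂ × ℂ), ‖ε‖ < 1 ∧ IsOpen V ∧
      DifferentiableOn ℂ f V ∧
      (∀ z ∈ orbitSpace p q c Λ, f (orbitCode ε z) = orbitCode ε fun i => z (i + 1)) ∧
      {x | ∀ i, f^[i] x ∈ V} = orbitCode ε '' orbitSpace p q c Λ := by
  have hp : p ≠ 0 := by omega
  obtain ⟨η₁, hη₁, r, hr, hsep⟩ := h.exists_image_separation hp hq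
  obtain ⟨η₂, hη₂, hiso⟩ := h.exists_isolating hq hpq
  obtain ⟨R, hR⟩ := h.isCompact.isBounded.exists_norm_le
  set η := min η₁ η₂ with hη
  have hη0 : 0 < η := lt_min hη₁ hη₂
  set e := min (1 / 2) (r / (2 * |R| + 1) / 2) with he
  have he0 : 0 < e := by positivity
  have heR : 2 * R * e < r := by
    have h1 : e ≤ r / (2 * |R| + 1) / 2 := min_le_right _ _
    have h2 : e < r / (2 * |R| + 1) := by
      have : 0 < r / (2 * |R| + 1) := by positivity
      linarith
    rw [lt_div_iff₀ (by positivity)] at h2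
    nlinarith [le_abs_self R]
  set ε : ℂ := (e : ℂ) with hεdef
  have hεe : ‖ε‖ = e := by rw [hεdef, Complex.norm_real, Real.norm_of_nonneg he0.le]
  have hε2 : ‖ε‖ ≤ 1 / 2 := hεe ▸ min_le_left _ _
  have hε1 : ‖ε‖ < 1 := by linarith
  have hε0 : ε ≠ 0 := norm_pos_iff.1 (by rw [hεe]; exact he0)
  let V : Set (ℂ × ℂ) := {x | x.1 ∈ Metric.thickening η Λ ∧
    ∃ v, IsImage p q c x.1 v ∧ ‖x.2 - v‖ < r}
  have hthick : ∀ {z : ℂ}, z ∈ Metric.thickening η Λ →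
      z ∈ Metric.thickening η₁ Λ ∧ z ∈ Metric.thickening η₂ Λ := fun hz =>
    ⟨Metric.thickening_mono (min_le_left _ _) _ hz, Metric.thickening_mono (min_le_right _ _) _ hz⟩
  have hex : ∀ x ∈ V, ∃ v, IsImage p q c x.1 v ∧ ‖x.2 - v‖ < r := fun x hx => hx.2
  choose! v hv hvr using hex
  have huniq : ∀ x ∈ V, ∀ w, IsImage p q c x.1 w → ‖x.2 - w‖ < r → v x = w :=
    fun x hx w hw hwr => (hsep _ (hthick hx.1).1).2 _ _ _ (hv x hx) hw (hvr x hx) hwr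
  let f : ℂ × ℂ → ℂ × ℂ := fun x => (v x, (x.2 - v x) / ε)
  have hlocal : ∀ x ∈ V, ∀ᶠ y in 𝓝 x, y ∈ V ∧ v y = localBranch p q c x.1 (v x) y.1 := by
    intro x hx
    have hx0 := (hsep _ (hthick hx.1).1).1
    have hcont : ContinuousAt (fun y : ℂ × ℂ => ‖y.2 - localBranch p q c x.1 (v x) y.1‖) x := by
      have h1 : ContinuousAt (localBranch p q c x.1 (v x)) x.1 :=
        (hasDerivAt_localBranch p q c (v x) hx0).continuousAt
      exact (continuousAt_snd.sub (h1.comp continuousAt_fst)).norm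
    have h2 : ∀ᶠ y in 𝓝 x, ‖y.2 - localBranch p q c x.1 (v x) y.1‖ < r :=
      hcont.eventually_lt continuousAt_const (by
        rw [localBranch_self p q c _ hx0]; exact hvr x hx)
    have h3 : ∀ᶠ y : ℂ × ℂ in 𝓝 x, y.1 ∈ Metric.thickening η Λ :=
      continuousAt_fst.eventually_mem (Metric.isOpen_thickening.mem_nhds hx.1)
    have h4 : ∀ᶠ y : ℂ × ℂ in 𝓝 x, IsImage p q c y.1 (localBranch p q c x.1 (v x) y.1) :=
      continuousAt_fst.eventually (eventually_isImage_localBranch p q c hq hx0 (hv x hx))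
    filter_upwards [h2, h3, h4] with y hy2 hy3 hy4
    have hyV : y ∈ V := ⟨hy3, _, hy4, hy2⟩
    exact ⟨hyV, huniq y hyV _ hy4 hy2⟩
  have hcode : ∀ z ∈ orbitSpace p q c Λ, orbitCode ε z ∈ V ∧
      f (orbitCode ε z) = orbitCode ε fun i => z (i + 1) := by
    intro z hz
    have hzR : ∀ i, ‖z i‖ ≤ R := fun i => hR _ (hz i).1
    have hsnd := orbitCode_snd_eq hε1 hzR
    have hlt : ‖(orbitCode ε z).2 - z 1‖ < r := by
      rw [hsnd, add_sub_cancel_left, norm_mul, hεe]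
      have := norm_orbitCode_snd_le hε2 fun i => hzR (i + 1)
      nlinarith
    have hV : orbitCode ε z ∈ V :=
      ⟨Metric.self_subset_thickening hη0 _ (hz 0).1, z 1, (hz 0).2, hlt⟩
    have hvz : v (orbitCode ε z) = z 1 := huniq _ hV _ (hz 0).2 hlt
    refine ⟨hV, Prod.ext hvz ?_⟩
    simp only [f]
    rw [hvz, hsnd, add_sub_cancel_left, mul_div_cancel_left₀ _ hε0]
  have hshift : ∀ z ∈ orbitSpace p q c Λ, ∀ j, (fun i => z (i + j)) ∈ orbitSpace p q c Λ :=
    fun z hz j i => by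
      simp only [add_right_comm i 1 j]
      exact hz (i + j)
  refine ⟨ε, V, f, hε1, ?_, ?_, fun z hz => (hcode z hz).2, ?_⟩
  · exact isOpen_iff_mem_nhds.2 fun x hx => (hlocal x hx).mono fun y hy => hy.1
  · intro x hx
    have hx0 := (hsep _ (hthick hx.1).1).1
    have hg : DifferentiableAt ℂ (fun y : ℂ × ℂ => localBranch p q c x.1 (v x) y.1) x :=
      (hasDerivAt_localBranch p q c (v x) hx0).differentiableAt.comp x differentiableAt_fst
    have hd : DifferentiableAt ℂ (fun y : ℂ × ℂ => (localBranch p q c x.1 (v x) y.1,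
        (y.2 - localBranch p q c x.1 (v x) y.1) / ε)) x := by
      simp only [div_eq_mul_inv]
      exact hg.prodMk ((differentiableAt_snd.sub hg).mul_const _)
    refine (hd.congr_of_eventuallyEq ?_).differentiableWithinAt
    filter_upwards [hlocal x hx] with y hy
    simp only [f]
    rw [hy.2]
  · ext x
    constructor
    · intro hx
      set z : ℕ → ℂ := projectedOrbit f x with hzdef
      set w : ℕ → ℂ := fun i => (f^[i] x).2 with hwdef
      have hx' : ∀ i, f^[i] x ∈ V := hx
      have hsucc : ∀ i, z (i + 1) = v (f^[i] x) ∧ w (i + 1) = (w i - z (i + 1)) / ε := by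
        intro i
        have h1 : f^[i + 1] x = f (f^[i] x) := Function.iterate_succ_apply' f i x
        have h2 : z (i + 1) = v (f^[i] x) := by rw [hzdef, projectedOrbit, h1]
        refine ⟨h2, ?_⟩
        rw [h2, hwdef]
        simp only [h1]
        rfl
      have hzo : ∀ i, IsImage p q c (z i) (z (i + 1)) := fun i => by
        rw [(hsucc i).1]
        exact hv _ (hx' i)
      have hzΛ := hiso z fun i => ⟨(hthick (hx' i).1).2, hzo i⟩
      have hzS : z ∈ orbitSpace p q c Λ := fun i => ⟨hzΛ i, hzo i⟩
      have hzR : ∀ i, ‖z i‖ ≤ R := fun i => hR _ (hzΛ i)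
      have hdiff : ∀ n, w 0 - (orbitCode ε z).2 =
          ε ^ n * (w n - (orbitCode ε fun i => z (i + n)).2) := by
        intro n
        induction n with
        | zero => simp
        | succ n ih =>
          rw [ih, orbitCode_snd_eq hε1 fun i => hzR (i + n), (hsucc n).2, pow_succ]
          simp only [add_assoc, add_comm 1 n]
          field_simp
          ring
      have hbound : ∀ n, ‖w n - (orbitCode ε fun i => z (i + n)).2‖ ≤ r + 3 * R := by
        intro n
        have h1 := hvr _ (hx' n)
        rw [← (hsucc n).1] at h1
        have h2 := norm_orbitCode_snd_le hε2 fun i => hzR (i + n)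
        have h3 := norm_sub_le (w n) (orbitCode ε fun i => z (i + n)).2
        have h4 := norm_le_norm_add_norm_sub' (w n) (z (n + 1))
        have h5 := hzR (n + 1)
        have h6 : ‖w n - z (n + 1)‖ < r := h1
        linarith
      have hw0 : w 0 = (orbitCode ε z).2 := by
        refine eq_of_sub_eq_zero ?_
        have hlim : Tendsto (fun n : ℕ => ‖ε‖ ^ n * (r + 3 * R)) atTop (𝓝 0) := by
          simpa using (tendsto_pow_atTop_nhds_zero_of_lt_one (norm_nonneg ε) hε1).mul_const
            (r + 3 * R)
        rw [← norm_le_zero_iff]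
        refine ge_of_tendsto' hlim fun n => ?_
        rw [hdiff n, norm_mul, norm_pow]
        exact mul_le_mul_of_nonneg_left (hbound n) (by positivity)
      exact ⟨z, hzS, Prod.ext rfl hw0.symm⟩
    · rintro ⟨z, hz, rfl⟩ i
      have hiter : ∀ i, f^[i] (orbitCode ε z) = orbitCode ε fun j => z (j + i) := by
        intro i
        induction i with
        | zero => rfl
        | succ i ih =>
          rw [Function.iterate_succ_apply', ih, (hcode _ (hshift z hz i)).2]
          simp only [add_assoc, add_comm 1 i]
      rw [hiter i]
      exact (hcode _ (hshift z hz i)).1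

end IsHyperbolicRepeller

theorem exists_isC2Extension {p q : ℕ} {c : ℂ} (hq : q ≠ 0) (hpq : q ≤ p)
    (h : IsHyperbolicRepeller p q c (juliaSet p q c)) (hLEO : IsLEO p q c (juliaSet p q c)) :
    ∃ (V : Set (ℂ × ℂ)) (f : ℂ × ℂ → ℂ × ℂ), IsC2Extension p q c V f := by
  have hp : p ≠ 0 := by omega
  obtain ⟨ε, V, f, hε, hV, hf, hcode, hinv⟩ := h.exists_coded_shift hq hpq
  obtain ⟨R, hR⟩ := h.isCompact.isBounded.exists_norm_le
  set S := orbitSpace p q c (juliaSet p q c) with hS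
  have hcont : ContinuousOn (orbitCode ε) S :=
    continuousOn_orbitCode hε fun z hz i => hR _ (hz i).1
  have hcomp : IsCompact (orbitCode ε '' S) :=
    (isCompact_orbitSpace h.isCompact).image_of_continuousOn hcont
  have hshift : ∀ z ∈ S, ∀ j, (fun i => z (i + j)) ∈ S := fun z hz j i => by
    simp only [add_right_comm i 1 j]
    exact hz (i + j)
  have hiter : ∀ z ∈ S, ∀ i, f^[i] (orbitCode ε z) = orbitCode ε fun j => z (j + i) := by
    intro z hz i
    induction i with
    | zero => rfl
    | succ i ih =>
      rw [Function.iterate_succ_apply', ih, hcode _ (hshift z hz i)]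
      simp only [add_assoc, add_comm 1 i]
  have hproj : ∀ z ∈ S, projectedOrbit f (orbitCode ε z) = z := fun z hz => by
    funext i
    rw [projectedOrbit, hiter z hz i]
    simp [orbitCode]
  have hJ : closurePeriodicPts V f = orbitCode ε '' S := by
    refine Set.Subset.antisymm (closure_minimal (fun x hx => ?_) hcomp.isClosed) ?_
    · rw [← hinv]
      exact hx.2
    · rintro _ ⟨z, hz, rfl⟩
      choose y hyS hyper hyz using fun n : ℕ =>
        h.exists_periodic_near hLEO hq hpq hz n (Nat.one_div_pos_of_nat (n := n) (α := ℝ))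
      have hyl : Tendsto y atTop (𝓝 z) := by
        refine tendsto_pi_nhds.2 fun i => ?_
        rw [tendsto_iff_norm_sub_tendsto_zero]
        refine squeeze_zero' (.of_forall fun _ => norm_nonneg _) ?_
          tendsto_one_div_add_atTop_nhds_zero_nat
        filter_upwards [eventually_ge_atTop i] with n hn
        exact (hyz n i hn).le
      refine mem_closure_of_tendsto ((hcont z hz).tendsto.comp
        (tendsto_nhdsWithin_iff.2 ⟨hyl, .of_forall hyS⟩)) (.of_forall fun n => ⟨?_, ?_⟩)
      · obtain ⟨m, hm, hper⟩ := hyper n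
        refine ⟨m, hm, ?_⟩
        simp only [Function.comp]
        rw [hiter _ (hyS n)]
        simp only [hper]
      · have : orbitCode ε (y n) ∈ orbitCode ε '' S := ⟨_, hyS n, rfl⟩
        rw [← hinv] at this
        exact this
  refine ⟨V, f, hV, hf, hJ ▸ hcomp, ?_, ?_, ?_, ?_⟩
  · rw [hJ, ← hinv]
    exact fun x hx => hx 0
  · rw [hJ]
    ext x
    constructor
    · rintro ⟨_, ⟨z, hz, rfl⟩, rfl⟩
      exact ⟨_, hshift z hz 1, (hcode z hz).symm⟩
    · rintro ⟨z, hz, rfl⟩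
      obtain ⟨v, hv⟩ := preimageFinset_nonempty (q := q) c (z 0) hp
      rw [mem_preimageFinset hp] at hv
      have hS' : (fun i => Nat.casesOn i v z : ℕ → ℂ) ∈ S := by
        intro i
        cases i with
        | zero => exact ⟨h.mem_of_isImage hv (hz 0).1, hv⟩
        | succ i => exact hz i
      exact ⟨_, ⟨_, hS', rfl⟩, hcode _ hS'⟩
  · rw [hJ, ← hinv]
    ext x
    constructor
    · rintro ⟨hxV, hx⟩ i
      cases i with
      | zero => exact hxV
      | succ i => exact hx i
    · intro hx
      exact ⟨hx 0, fun i => hx (i + 1)⟩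
  · rw [hJ]
    refine ⟨?_, ?_, fun z hz => ⟨_, ⟨z, hz, rfl⟩, hproj z hz⟩⟩
    · rintro _ ⟨z, hz, rfl⟩
      rw [hproj z hz]
      exact hz
    · rintro _ ⟨z, hz, rfl⟩ _ ⟨z', hz', rfl⟩ heq
      rw [hproj z hz, hproj z' hz'] at heq
      rw [heq]

end Corr

end

theorem mainTheorem1 (p q : ℕ) (hq : 2 ≤ q) (hpq : q < p) (c : ℂ)
    (hne : (Corr.juliaSet p q c).Nonempty)
    (hrep : Corr.IsHyperbolicRepeller p q c (Corr.juliaSet p q c))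
    (hLEO : Corr.IsLEO p q c (Corr.juliaSet p q c)) :
    (∃ (V : Set (ℂ × ℂ)) (f : ℂ × ℂ → ℂ × ℂ), Corr.IsC2Extension p q c V f) ∧
    ∃ t : ℝ, 0 < t ∧
      (∀ (V : Set (ℂ × ℂ)) (f : ℂ × ℂ → ℂ × ℂ), Corr.IsC2Extension p q c V f →
        ∀ s : ℝ, 0 ≤ s →
          (Corr.pressure f (Corr.closurePeriodicPts V f)
            (fun x => s * Corr.geometricPotential p q c f x) = 0 ↔ s = t)) ∧
      MeasureTheory.Measure.hausdorffMeasure t (Corr.juliaSet p q c) < ⊤ ∧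
      dimH (Corr.juliaSet p q c) ≤ ENNReal.ofReal t := by
  have hq0 : q ≠ 0 := by omega
  refine ⟨Corr.exists_isC2Extension hq0 hpq.le hrep hLEO, ?_⟩
  obtain ⟨P, hP⟩ := hrep.exists_pressureFunction hLEO hne hq0 hpq.le
  obtain ⟨t, ht, hzero⟩ := hrep.exists_pressureFunction_zero hne hq0 hpq hP
  have hfin : MeasureTheory.Measure.hausdorffMeasure t (Corr.juliaSet p q c) < ⊤ := by
    obtain ⟨k, hk⟩ := hP t
    refine hrep.hausdorffMeasure_lt_top hq0 hpq.le (B := Real.exp k) ht.le fun n w hw => ?_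
    have := (hk n w hw).2
    rwa [(hzero t).2 rfl, mul_zero, zero_add] at this
  refine ⟨t, ht, fun V f hf s _ => ?_, hfin, ?_⟩
  · obtain ⟨k, hk⟩ := hP s
    rw [hf.pressure_eq hrep hne hq0 hpq.le hk, EReal.coe_eq_zero]
    exact hzero s
  · refine dimH_le_of_hausdorffMeasure_ne_top (d := t.toNNReal) ?_
    rw [Real.coe_toNNReal _ ht.le]
    exact hfin.ne
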